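/- Fix an alphabet containing three distinct letters $a,b,c$. A timed word is a nonempty finite sequence $(\sigma_1,\tau_1)\dots(\sigma_N,\tau_N)$ of letters with real time stamps, $\tau_1=0$ and $\tau_1\le\dots\le\tau_N$ (weakly monotonic); it is strictly monotonic if $\tau_1<\dots<\tau_N$. $\mathrm{MTL}[U,S]$ is built from letters by Boolean connectives and $\varphi\,U_I\,\psi$, $\varphi\,S_I\,\psi$, where $I\subseteq[0,\infty)$ is an interval (open, closed or half-open, possibly singular) with end points in $\mathbb N\cup\{\infty\}$: $\rho,i\models\varphi\,U_I\,\psi$ iff there is $j>i$ with $\rho,j\models\psi$, $\tau_j-\tau_i\in I$ and $\rho,l\models\varphi$ for all $i<l<j$; $S_I$ is the mirror image. $\mathrm{TPTL}[U,S]$ is built from letters and timing constraints (conjunctions of $x-T\approx d$ with ${\approx}\in\{<,\le,>,\ge,=\}$, $d\in\mathbb Z$, $x$ a freeze variable, $T$ the current time stamp) by Boolean connectives, the untimed strict $U$, $S$, and the freeze quantifier $x.\varphi$, which sets $x$ to the current time stamp; all freeze variables are initially $0$. $\mathrm{TPTL}[F]$ is the fragment whose only temporal modality is $F\varphi:=\top\,U\,\varphi$.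 The language of a formula is the set of timed words that satisfy it at position $1$; over a class $\mathcal C$ of timed words, one logic is contained in another if every language $L(\varphi)\cap\mathcal C$ with $\varphi$ in the first has the form $L(\psi)\cap\mathcal C$ with $\psi$ in the second. **Theorem.** 1. $\mathrm{TPTL}[F]\not\subseteq\mathrm{MTL}[U,S]$ over strictly monotonic timed words, and likewise over weakly monotonic timed words. 2. In fact the $\mathrm{TPTL}[F]$ formula $$\phi:=F\,p.\bigl(a\wedge F\,(b\wedge T-p\in(1,2)\wedge F\,(c\wedge T-p\in(1,2)))\bigr)$$ is equivalent over neither class to an $\mathrm{MTL}[U,S]$ formula. It holds in a timed word iff there are positions $1<i<j<l$ with $\sigma_i=a$, $\sigma_j=b$, $\sigma_l=c$ and $\tau_j-\tau_i,\ \tau_l-\tau_i\in(1,2)$. 3. For $n,k\ge 1$ let $m=2n(k+1)+1$, $\delta=\frac1{2m}$, $X=n(k+1)+1$. Let $0<\varepsilon<\delta/4$, $s\ge k+1$ and $t_i=s+(i-1)(1-\delta)$ for $1\le i\le m$. Let $\mathcal B_{n,k}$ be any strictly monotonic timed word consisting of an $a$ at time $0$ and, for $1\le i\le m$, an $a$ at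 $t_i$, a $b$ in $(t_i+2-2\delta+2\varepsilon,\ t_i+2-\delta-2\varepsilon)$ and a $c$ in $(t_i+2,\ t_i+2+\varepsilon)$. Let $\mathcal A_{n,k}$ be obtained from it by moving the $c$ of the $X$-th segment into $(t_X+2-\varepsilon,\ t_X+2)$. Suppose that neither word has two events at an integral distance. Such pairs of words exist for all $n,k\ge1$, and for every such pair $\mathcal A_{n,k}\models\phi$, $\mathcal B_{n,k}\not\models\phi$, and Duplicator has a winning strategy in the following game on $(\mathcal A_{n,k},\mathcal B_{n,k})$, played for $n$ rounds from the configuration $(1,1)$ (the $n$-round $\mathbb Z^k$-$\mathrm{MTL}[U,S]$ Ehrenfeucht–Fraïssé game). A configuration is a pair of positions, one in each word; Spoiler wins as soon as the two letters of the current configuration differ, including after the last round. In a round, Spoiler chooses one of the words, an interval $I$ whose finite end points are at most $k$, a $U_I$-move or an $S_I$-move, and in the chosen word, with current position $i$, a position $i'>i$ with $\tau_{i'}-\tau_i\in I$. Duplicator must answer in the other word, with current position $j$, by some $j'>j$ at a time distance in $I$ from $j$. Spoiler then either ends the round in $(i',j')$, or compares adjacency. In the latter case Spoiler wins unless $i'=i+1\iff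 j'=j+1$; if both hold, the round ends in $(i',j')$; otherwise Spoiler chooses $j''$ with $j<j''<j'$, Duplicator must answer by $i''$ with $i<i''<i'$, and the round ends in $(i'',j'')$. $S_I$-moves are the mirror image. 4. $\mathrm{MTL}[U,S]\subsetneq\mathrm{TPTL}[U,S]$, over strictly monotonic and over weakly monotonic timed words. -/

import Mathlib

/-- A (nonempty) finite timed word over the alphabet `α`: a sequence of events, each with a letter
and a time stamp; the time stamps are non-decreasing and start at `0`. The positions `1, …, n` are
represented by `Fin length`, so the first position is `⟨0, _⟩`. -/
structure TimedWord (α : Type*) where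
  length : ℕ
  length_pos : 0 < length
  letter : Fin length → α
  time : Fin length → ℝ
  monotone_time : Monotone time
  time_first : time ⟨0, length_pos⟩ = 0

namespace TimedWord

variable {α : Type*}

/-- The first position of a timed word. -/
def first (ρ : TimedWord α) : Fin ρ.length := ⟨0, ρ.length_pos⟩

/-- The class of strictly monotonic timed words. -/
def strict (α : Type*) : Set (TimedWord α) := {ρ | StrictMono ρ.time}

/-- The class of all (weakly monotonic) timed words. -/
def weak (α : Type*) : Set (TimedWord α) := Set.univ

/-- `ρ` is the strictly monotonic timed word whose set of events is `E`. -/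
def HasEvents (ρ : TimedWord α) (E : Set (α × ℝ)) : Prop :=
  ρ ∈ strict α ∧ Set.range (fun i => (ρ.letter i, ρ.time i)) = E

end TimedWord

/-- Intervals bounded by non-negative integer constants or `∞`, with open or closed ends. -/
inductive TimeInterval where
  | cc (l h : ℕ)
  | co (l h : ℕ)
  | oc (l h : ℕ)
  | oo (l h : ℕ)
  | ci (l : ℕ)
  | oi (l : ℕ)

namespace TimeInterval

/-- The set of reals denoted by an interval. -/
def toSet : TimeInterval → Set ℝ
  | cc l h => Set.Icc (l : ℝ) (h : ℝ)
  | co l h => Set.Ico (l : ℝ) (h : ℝ)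
  | oc l h => Set.Ioc (l : ℝ) (h : ℝ)
  | oo l h => Set.Ioo (l : ℝ) (h : ℝ)
  | ci l => Set.Ici (l : ℝ)
  | oi l => Set.Ioi (l : ℝ)

/-- All finite end points of the interval are at most `k`. -/
def BoundedBy (k : ℕ) : TimeInterval → Prop
  | cc l h => l ≤ k ∧ h ≤ k
  | co l h => l ≤ k ∧ h ≤ k
  | oc l h => l ≤ k ∧ h ≤ k
  | oo l h => l ≤ k ∧ h ≤ k
  | ci l => l ≤ k
  | oi l => l ≤ k

/-- The set `ℤ^k` of the intervals `⟨i, j⟩` and `⟨i, ∞)` with `i, j ≤ k`. -/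
def upTo (k : ℕ) : Set TimeInterval := {I | I.BoundedBy k}

end TimeInterval

/-- Formulas of `MTL[U,S]`. The usual abbreviation `⊤` is taken as a primitive. -/
inductive MTL (α : Type*) where
  | top : MTL α
  | atom (a : α) : MTL α
  | neg (φ : MTL α) : MTL α
  | and (φ ψ : MTL α) : MTL α
  | untl (I : TimeInterval) (φ ψ : MTL α) : MTL α
  | since (I : TimeInterval) (φ ψ : MTL α) : MTL α

namespace MTL

variable {α : Type*}

/-- `ρ, i ⊨ φ` (pointwise semantics with strict until and since). -/
def Sat (ρ : TimedWord α) : MTL α → Fin ρ.length → Prop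
  | top, _ => True
  | atom a, i => ρ.letter i = a
  | neg φ, i => ¬ Sat ρ φ i
  | and φ ψ, i => Sat ρ φ i ∧ Sat ρ ψ i
  | untl I φ ψ, i => ∃ j, i < j ∧ Sat ρ ψ j ∧ ρ.time j - ρ.time i ∈ I.toSet ∧
      ∀ k, i < k → k < j → Sat ρ φ k
  | since I φ ψ, i => ∃ j, j < i ∧ Sat ρ ψ j ∧ ρ.time i - ρ.time j ∈ I.toSet ∧
      ∀ k, j < k → k < i → Sat ρ φ k

/-- The language of a formula. -/
def lang (φ : MTL α) : Set (TimedWord α) := {ρ | Sat ρ φ ρ.first}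

/-- The languages definable in `MTL[U,S]` over a class `C` of timed words. -/
def languages (C : Set (TimedWord α)) : Set (Set (TimedWord α)) :=
  {L | ∃ φ : MTL α, L = φ.lang ∩ C}

end MTL

/-- The comparison symbols `<, ≤, >, ≥, =`. -/
inductive Cmp where
  | lt
  | le
  | gt
  | ge
  | eq

/-- The relation on the reals denoted by a comparison symbol. -/
def Cmp.Holds : Cmp → ℝ → ℝ → Prop
  | lt, x, y => x < y
  | le, x, y => x ≤ y
  | gt, x, y => x > y
  | ge, x, y => x ≥ y
  | eq, x, y => x = y

/-- Timing constraints: conjunctions of constraints `x - T ≈ c`, where `x` is a freeze variable,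
`T` the current time and `c` an integer. Freeze variables are named by natural numbers (every
formula uses finitely many of them). -/
inductive Guard where
  | cmp (x : ℕ) (r : Cmp) (c : ℤ) : Guard
  | and (g₁ g₂ : Guard) : Guard

/-- `ν, t ⊨ g`. -/
def Guard.Holds (ν : ℕ → ℝ) (t : ℝ) : Guard → Prop
  | cmp x r c => r.Holds (ν x - t) (c : ℝ)
  | and g₁ g₂ => g₁.Holds ν t ∧ g₂.Holds ν t

/-- Formulas of `TPTL[U,S]`. The usual abbreviation `⊤` is taken as a primitive. -/
inductive TPTL (α : Type*) where
  | top : TPTL α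
  | atom (a : α) : TPTL α
  | guard (g : Guard) : TPTL α
  | untl (φ ψ : TPTL α) : TPTL α
  | since (φ ψ : TPTL α) : TPTL α
  | freeze (x : ℕ) (φ : TPTL α) : TPTL α
  | or (φ ψ : TPTL α) : TPTL α
  | neg (φ : TPTL α) : TPTL α

namespace TPTL

variable {α : Type*}

/-- `ρ, i, ν ⊨ φ`. -/
def Sat (ρ : TimedWord α) : TPTL α → Fin ρ.length → (ℕ → ℝ) → Prop
  | top, _, _ => True
  | atom a, i, _ => ρ.letter i = a
  | guard g, i, ν => g.Holds ν (ρ.time i)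
  | untl φ ψ, i, ν => ∃ j, i < j ∧ Sat ρ ψ j ν ∧ ∀ k, i < k → k < j → Sat ρ φ k ν
  | since φ ψ, i, ν => ∃ j, j < i ∧ Sat ρ ψ j ν ∧ ∀ k, j < k → k < i → Sat ρ φ k ν
  | freeze x φ, i, ν => Sat ρ φ i (Function.update ν x (ρ.time i))
  | or φ ψ, i, ν => Sat ρ φ i ν ∨ Sat ρ ψ i ν
  | neg φ, i, ν => ¬ Sat ρ φ i ν

/-- The language of a formula: evaluation at the first position, all freeze variables being
initially `0`. -/
def lang (φ : TPTL α) : Set (TimedWord α) := {ρ | Sat ρ φ ρ.first (fun _ => 0)}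

/-- Conjunction. -/
def and (φ ψ : TPTL α) : TPTL α := neg (or (neg φ) (neg ψ))

/-- The unary modality `F φ := ⊤ U φ`. -/
def ev (φ : TPTL α) : TPTL α := untl top φ

/-- The unary future fragment `TPTL[F]`: `F` is the only temporal modality. -/
inductive IsUnaryFuture : TPTL α → Prop where
  | top : IsUnaryFuture top
  | atom (a : α) : IsUnaryFuture (atom a)
  | guard (g : Guard) : IsUnaryFuture (guard g)
  | ev {φ : TPTL α} : IsUnaryFuture φ → IsUnaryFuture (ev φ)
  | freeze (x : ℕ) {φ : TPTL α} : IsUnaryFuture φ → IsUnaryFuture (freeze x φ)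
  | or {φ ψ : TPTL α} : IsUnaryFuture φ → IsUnaryFuture ψ → IsUnaryFuture (or φ ψ)
  | neg {φ : TPTL α} : IsUnaryFuture φ → IsUnaryFuture (neg φ)

/-- The languages definable in `TPTL[U,S]` over a class `C` of timed words. -/
def languages (C : Set (TimedWord α)) : Set (Set (TimedWord α)) :=
  {L | ∃ φ : TPTL α, L = φ.lang ∩ C}

/-- The languages definable in `TPTL[F]` over a class `C` of timed words. -/
def languagesF (C : Set (TimedWord α)) : Set (Set (TimedWord α)) :=
  {L | ∃ φ : TPTL α, φ.IsUnaryFuture ∧ L = φ.lang ∩ C}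

/-- The constraint `T - x ∈ (1,2)`, that is `x - T < -1 ∧ x - T > -2`. -/
def within (x : ℕ) : TPTL α := guard (Guard.and (Guard.cmp x Cmp.lt (-1)) (Guard.cmp x Cmp.gt (-2)))

/-- The formula `F p.(a ∧ F (b ∧ T - p ∈ (1,2) ∧ F (c ∧ T - p ∈ (1,2))))`. -/
def witness (a b c : α) : TPTL α :=
  ev (freeze 0 (and (atom a)
    (ev (and (atom b) (and (within 0) (ev (and (atom c) (within 0))))))))

end TPTL

/-! ### Ehrenfeucht–Fraïssé games for `MTL` -/

section Games

variable {α : Type*}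

/-- Duplicator can answer every `U_I`-move which Spoiler starts in `ρ`, from position `i` of `ρ` and
position `j` of `σ`, so that the round ends in a configuration satisfying `R`. Spoiler picks `i'`,
Duplicator answers `j'`; then Spoiler chooses the `F`-part (the round ends in `(i', j')`) or the
`U`-part (adjacency is compared and, if `i'` is not adjacent to `i`, Spoiler picks `j''` strictly
between `j` and `j'` and Duplicator answers `i''` strictly between `i` and `i'`). -/
def UntilMove (ρ σ : TimedWord α) (I : TimeInterval)
    (R : Fin ρ.length → Fin σ.length → Prop) (i : Fin ρ.length) (j : Fin σ.length) : Prop :=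
  ∀ i', i < i' → ρ.time i' - ρ.time i ∈ I.toSet →
    ∃ j', j < j' ∧ σ.time j' - σ.time j ∈ I.toSet ∧ R i' j' ∧
      ((i' : ℕ) = i + 1 ↔ (j' : ℕ) = j + 1) ∧
      ((i' : ℕ) ≠ i + 1 → ∀ j'', j < j'' → j'' < j' → ∃ i'', i < i'' ∧ i'' < i' ∧ R i'' j'')

/-- The mirror image of `UntilMove` for `S_I`-moves. -/
def SinceMove (ρ σ : TimedWord α) (I : TimeInterval)
    (R : Fin ρ.length → Fin σ.length → Prop) (i : Fin ρ.length) (j : Fin σ.length) : Prop :=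
  ∀ i', i' < i → ρ.time i - ρ.time i' ∈ I.toSet →
    ∃ j', j' < j ∧ σ.time j - σ.time j' ∈ I.toSet ∧ R i' j' ∧
      ((i : ℕ) = i' + 1 ↔ (j : ℕ) = j' + 1) ∧
      ((i : ℕ) ≠ i' + 1 → ∀ j'', j' < j'' → j'' < j → ∃ i'', i' < i'' ∧ i'' < i ∧ R i'' j'')

/-- Duplicator has a winning strategy in the `r`-round game with intervals from `J`, from the
configuration `(i, j)`. In each round Spoiler chooses one of the two words, an interval `I ∈ J`,
and a `U_I`-move or an `S_I`-move. -/
def DuplicatorWinsFrom (J : Set TimeInterval) (ρ σ : TimedWord α) :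
    ℕ → Fin ρ.length → Fin σ.length → Prop
  | 0, i, j => ρ.letter i = σ.letter j
  | r + 1, i, j => ρ.letter i = σ.letter j ∧ ∀ I ∈ J,
      UntilMove ρ σ I (DuplicatorWinsFrom J ρ σ r) i j ∧
      UntilMove σ ρ I (fun j' i' => DuplicatorWinsFrom J ρ σ r i' j') j i ∧
      SinceMove ρ σ I (DuplicatorWinsFrom J ρ σ r) i j ∧
      SinceMove σ ρ I (fun j' i' => DuplicatorWinsFrom J ρ σ r i' j') j i

/-- Duplicator wins the `r`-round game with intervals from `J`, starting at the first positions. -/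
def DuplicatorWins (J : Set TimeInterval) (r : ℕ) (ρ σ : TimedWord α) : Prop :=
  DuplicatorWinsFrom J ρ σ r ρ.first σ.first

end Games

/-! ### Words made of overlapping segments -/

/-- The number of segments, `m = 2n(k+1) + 1`. -/
def segCount (n k : ℕ) : ℕ := 2 * n * (k + 1) + 1

/-- The overlap parameter `δ = 1/(2m)`. -/
noncomputable def segDelta (n k : ℕ) : ℝ := 1 / (2 * (segCount n k : ℝ))

/-- The index `X` of the middle segment. -/
def segMid (n k : ℕ) : ℕ := n * (k + 1) + 1

/-- The start of segment `i` (for `1 ≤ i ≤ m`), when the first segment starts at `s`. -/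
noncomputable def segStart (n k : ℕ) (s : ℝ) (i : ℕ) : ℝ := s + ((i : ℝ) - 1) * (1 - segDelta n k)

/-- The events of the word with an `a` at time `0` and, for each segment `1 ≤ i ≤ m`, an `a` at its
start, a `b` at time `β i` and a `c` at time `γ i`. -/
def segEvents {α : Type*} (a b c : α) (n k : ℕ) (s : ℝ) (β γ : ℕ → ℝ) : Set (α × ℝ) :=
  {e | e = (a, 0) ∨ ∃ i, 1 ≤ i ∧ i ≤ segCount n k ∧
    (e = (a, segStart n k s i) ∨ e = (b, β i) ∨ e = (c, γ i))}

/-- No two distinct events are at an integral distance. -/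
def NoIntegralDistance {α : Type*} (E : Set (α × ℝ)) : Prop :=
  ∀ e ∈ E, ∀ f ∈ E, e ≠ f → ∀ z : ℤ, e.2 - f.2 ≠ (z : ℝ)

/-- `(A, B)` is a pair of segment words with parameters `n, k`. In `B` each segment, starting at `t`,
has its `a` at `t`, its `b` in `(t + 2 - 2δ + 2ε, t + 2 - δ - 2ε)` and its `c` in `(t + 2, t + 2 + ε)`;
`A` differs from `B` only in that the `c` of the middle segment, starting at `x`, is moved to
`(x + 2 - ε, x + 2)`. The segments start from time `k + 1` onwards. -/
def IsSegmentPair {α : Type*} (a b c : α) (n k : ℕ) (A B : TimedWord α) : Prop :=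
  ∃ (ε s : ℝ) (β γ : ℕ → ℝ) (γ' : ℝ),
    0 < ε ∧ 4 * ε < segDelta n k ∧ (k : ℝ) + 1 ≤ s ∧
    (∀ i, 1 ≤ i → i ≤ segCount n k →
      β i ∈ Set.Ioo (segStart n k s i + 2 - 2 * segDelta n k + 2 * ε)
        (segStart n k s i + 2 - segDelta n k - 2 * ε) ∧
      γ i ∈ Set.Ioo (segStart n k s i + 2) (segStart n k s i + 2 + ε)) ∧
    γ' ∈ Set.Ioo (segStart n k s (segMid n k) + 2 - ε) (segStart n k s (segMid n k) + 2) ∧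
    B.HasEvents (segEvents a b c n k s β γ) ∧
    A.HasEvents (segEvents a b c n k s β (Function.update γ (segMid n k) γ')) ∧
    NoIntegralDistance (segEvents a b c n k s β γ) ∧
    NoIntegralDistance (segEvents a b c n k s β (Function.update γ (segMid n k) γ'))

/-!
`MTL[U,S]` formulas of depth `n` with constants up to `k` cannot separate two words on which
Duplicator wins the `n`-round game with constants up to `k` (`DuplicatorWinsFrom.sat_iff`). So the
inexpressibility of the witness formula reduces to the segment words `A` and `B`, and the other
separations follow from it, together with the translation `MTL.toTPTL` of `MTL[U,S]` into
`TPTL[U,S]`.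

Since consecutive segments start `1 - δ` apart, the events of a segment word form clusters
`a_q, b_{q-2}, c_{q-2}`, where the `a` of segment `q` comes together with the `b` and the `c` of
segment `q - 2`. Coding these three events by `3 * q`, `3 * q + 1`, `3 * q + 2` turns the order of
the word into the order of the natural numbers, and the integral part of the distance of two events
becomes a function `unitDist` of their codes which is invariant under shifts by whole clusters
(`SegmentTimes.unitDist_spec`). The words `A` and `B` have the same codes, and their integral
distances differ for one pair only: the `a` and the `c` of the middle segment `X` have integral
distance `1` in `A` and `2` in `B`. As the `b` between them has integral distance `1` from that `a`,
this is what the witness formula detects.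

Duplicator keeps the two positions equal, or at the same letter in clusters which are far from both
ends of the word (`CodeSimilar`). She copies Spoiler's moves, up to the shift between the two
positions. If Spoiler uses the exceptional pair, she answers with a neighbouring cluster instead: from
`a_X` the distance to `c_X` in `A` has the same integral part as the distance to `c_{X-1}` in `B`, and
the distance to `c_X` in `B` the same as the one to `c_{X+1}` in `A`. The events passed over are
still matched, at worst by their neighbours one cluster away. A move over more than `k + 1` clusters
is only observed to be long, and contains each letter; so Duplicator is free to return to equal
positions when Spoiler comes near to an end of the word. Each round costs at most `k + 1` clusters on
either side, and `n * (k + 1)` segments are available on each side of the middle one.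
-/

/-! ### Soundness of the game -/

namespace TimeInterval

/-- The largest finite end point of an interval. -/
def maxConst : TimeInterval → ℕ
  | cc l h => max l h
  | co l h => max l h
  | oc l h => max l h
  | oo l h => max l h
  | ci l => l
  | oi l => l

theorem mem_upTo_of_maxConst_le {k : ℕ} {I : TimeInterval} (h : I.maxConst ≤ k) : I ∈ upTo k := by
  cases I <;> simp_all [upTo, BoundedBy, maxConst]

end TimeInterval

namespace MTL

variable {α : Type*}

/-- The nesting depth of the temporal modalities of a formula. -/
def depth : MTL α → ℕ
  | top => 0
  | atom _ => 0
  | neg φ => depth φ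
  | and φ ψ => max (depth φ) (depth ψ)
  | untl _ φ ψ => max (depth φ) (depth ψ) + 1
  | since _ φ ψ => max (depth φ) (depth ψ) + 1

/-- The largest finite end point of the intervals of a formula. -/
def maxConst : MTL α → ℕ
  | top => 0
  | atom _ => 0
  | neg φ => maxConst φ
  | and φ ψ => max (maxConst φ) (maxConst ψ)
  | untl I φ ψ => max I.maxConst (max (maxConst φ) (maxConst ψ))
  | since I φ ψ => max I.maxConst (max (maxConst φ) (maxConst ψ))

end MTL

section Soundness

variable {α : Type*} {ρ σ : TimedWord α} {I : TimeInterval}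

theorem UntilMove.sat {R : Fin ρ.length → Fin σ.length → Prop} {i : Fin ρ.length}
    {j : Fin σ.length} {φ ψ : MTL α} (h : UntilMove ρ σ I R i j)
    (hφ : ∀ i j, R i j → φ.Sat ρ i → φ.Sat σ j) (hψ : ∀ i j, R i j → ψ.Sat ρ i → ψ.Sat σ j)
    (hs : (MTL.untl I φ ψ).Sat ρ i) : (MTL.untl I φ ψ).Sat σ j := by
  obtain ⟨i', hi, hsat, hI, hbetween⟩ := hs
  obtain ⟨j', hj, hJ, hR, hadj, hu⟩ := h i' hi hI
  refine ⟨j', hj, hψ _ _ hR hsat, hJ, fun j'' h1 h2 => ?_⟩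
  have hne : (i' : ℕ) ≠ i + 1 := fun he => by
    have := hadj.1 he
    simp only [Fin.lt_def] at h1 h2
    omega
  obtain ⟨i'', h3, h4, hR'⟩ := hu hne j'' h1 h2
  exact hφ _ _ hR' (hbetween _ h3 h4)

theorem SinceMove.sat {R : Fin ρ.length → Fin σ.length → Prop} {i : Fin ρ.length}
    {j : Fin σ.length} {φ ψ : MTL α} (h : SinceMove ρ σ I R i j)
    (hφ : ∀ i j, R i j → φ.Sat ρ i → φ.Sat σ j) (hψ : ∀ i j, R i j → ψ.Sat ρ i → ψ.Sat σ j)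
    (hs : (MTL.since I φ ψ).Sat ρ i) : (MTL.since I φ ψ).Sat σ j := by
  obtain ⟨i', hi, hsat, hI, hbetween⟩ := hs
  obtain ⟨j', hj, hJ, hR, hadj, hu⟩ := h i' hi hI
  refine ⟨j', hj, hψ _ _ hR hsat, hJ, fun j'' h1 h2 => ?_⟩
  have hne : (i : ℕ) ≠ i' + 1 := fun he => by
    have := hadj.1 he
    simp only [Fin.lt_def] at h1 h2
    omega
  obtain ⟨i'', h3, h4, hR'⟩ := hu hne j'' h1 h2
  exact hφ _ _ hR' (hbetween _ h3 h4)

theorem DuplicatorWinsFrom.letter_eq {J : Set TimeInterval} {r : ℕ} {i : Fin ρ.length}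
    {j : Fin σ.length} (h : DuplicatorWinsFrom J ρ σ r i j) : ρ.letter i = σ.letter j := by
  cases r with
  | zero => exact h
  | succ r => exact h.1

/-- Soundness of the game: a formula of depth at most `r` with constants at most `k` cannot tell
apart the two positions of a configuration from which Duplicator survives `r` rounds. -/
theorem DuplicatorWinsFrom.sat_iff {k : ℕ} (φ : MTL α) {r : ℕ} (hr : φ.depth ≤ r)
    (hk : φ.maxConst ≤ k) {i : Fin ρ.length} {j : Fin σ.length}
    (h : DuplicatorWinsFrom (TimeInterval.upTo k) ρ σ r i j) : φ.Sat ρ i ↔ φ.Sat σ j := by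
  induction φ generalizing r i j with
  | top => exact Iff.rfl
  | atom a => simp only [MTL.Sat, h.letter_eq]
  | neg φ ih => exact not_congr (ih hr hk h)
  | and φ ψ ihφ ihψ =>
    simp only [MTL.depth, MTL.maxConst, max_le_iff] at hr hk
    exact and_congr (ihφ hr.1 hk.1 h) (ihψ hr.2 hk.2 h)
  | untl I φ ψ ihφ ihψ =>
    cases r with
    | zero => simp [MTL.depth] at hr
    | succ r =>
      simp only [MTL.depth, MTL.maxConst, Nat.add_le_add_iff_right, max_le_iff] at hr hk
      obtain ⟨h1, h2, -, -⟩ := h.2 I (TimeInterval.mem_upTo_of_maxConst_le hk.1)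
      exact ⟨h1.sat (fun _ _ h => (ihφ hr.1 hk.2.1 h).1) (fun _ _ h => (ihψ hr.2 hk.2.2 h).1),
        h2.sat (fun _ _ h => (ihφ hr.1 hk.2.1 h).2) (fun _ _ h => (ihψ hr.2 hk.2.2 h).2)⟩
  | since I φ ψ ihφ ihψ =>
    cases r with
    | zero => simp [MTL.depth] at hr
    | succ r =>
      simp only [MTL.depth, MTL.maxConst, Nat.add_le_add_iff_right, max_le_iff] at hr hk
      obtain ⟨-, -, h1, h2⟩ := h.2 I (TimeInterval.mem_upTo_of_maxConst_le hk.1)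
      exact ⟨h1.sat (fun _ _ h => (ihφ hr.1 hk.2.1 h).1) (fun _ _ h => (ihψ hr.2 hk.2.2 h).1),
        h2.sat (fun _ _ h => (ihφ hr.1 hk.2.1 h).2) (fun _ _ h => (ihψ hr.2 hk.2.2 h).2)⟩

/-- A language which for all large `n, k` separates two words of `C` on which Duplicator wins the
`n`-round game with constants at most `k` is not definable in `MTL[U,S]` over `C`. -/
theorem inter_notMem_languages {C L : Set (TimedWord α)}
    (h : ∀ n k : ℕ, 0 < n → 0 < k → ∃ A ∈ C, ∃ B ∈ C, A ∈ L ∧ B ∉ L ∧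
      DuplicatorWins (TimeInterval.upTo k) n A B) : L ∩ C ∉ MTL.languages C := by
  rintro ⟨φ, hφ⟩
  obtain ⟨A, hAC, B, hBC, hA, hB, hwin⟩ :=
    h (φ.depth + 1) (φ.maxConst + 1) (Nat.succ_pos _) (Nat.succ_pos _)
  have hAφ : A ∈ φ.lang ∩ C := hφ ▸ ⟨hA, hAC⟩
  have hBφ : B ∈ L ∩ C :=
    hφ.symm ▸ ⟨(DuplicatorWinsFrom.sat_iff φ (Nat.le_succ _) (Nat.le_succ _) hwin).1 hAφ.1, hBC⟩
  exact hB hBφ.1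

end Soundness

/-! ### Embedding `MTL[U,S]` into `TPTL[U,S]` -/

namespace TimeInterval

/-- The guard `T - x ∈ I` for the freeze variable `x = 0`. -/
def afterGuard : TimeInterval → Guard
  | cc l h => (Guard.cmp 0 Cmp.le (-l)).and (Guard.cmp 0 Cmp.ge (-h))
  | co l h => (Guard.cmp 0 Cmp.le (-l)).and (Guard.cmp 0 Cmp.gt (-h))
  | oc l h => (Guard.cmp 0 Cmp.lt (-l)).and (Guard.cmp 0 Cmp.ge (-h))
  | oo l h => (Guard.cmp 0 Cmp.lt (-l)).and (Guard.cmp 0 Cmp.gt (-h))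
  | ci l => Guard.cmp 0 Cmp.le (-l)
  | oi l => Guard.cmp 0 Cmp.lt (-l)

/-- The guard `x - T ∈ I` for the freeze variable `x = 0`. -/
def beforeGuard : TimeInterval → Guard
  | cc l h => (Guard.cmp 0 Cmp.ge l).and (Guard.cmp 0 Cmp.le h)
  | co l h => (Guard.cmp 0 Cmp.ge l).and (Guard.cmp 0 Cmp.lt h)
  | oc l h => (Guard.cmp 0 Cmp.gt l).and (Guard.cmp 0 Cmp.le h)
  | oo l h => (Guard.cmp 0 Cmp.gt l).and (Guard.cmp 0 Cmp.lt h)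
  | ci l => Guard.cmp 0 Cmp.ge l
  | oi l => Guard.cmp 0 Cmp.gt l

theorem afterGuard_holds (I : TimeInterval) (ν : ℕ → ℝ) (t : ℝ) :
    I.afterGuard.Holds ν t ↔ t - ν 0 ∈ I.toSet := by
  cases I <;> simp only [afterGuard, Guard.Holds, Cmp.Holds, toSet, Set.mem_Icc, Set.mem_Ico,
    Set.mem_Ioc, Set.mem_Ioo, Set.mem_Ici, Set.mem_Ioi, Int.cast_neg, Int.cast_natCast] <;>
    first
      | exact and_congr (by constructor <;> intro <;> linarith)
          (by constructor <;> intro <;> linarith)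
      | (constructor <;> intro <;> linarith)

theorem beforeGuard_holds (I : TimeInterval) (ν : ℕ → ℝ) (t : ℝ) :
    I.beforeGuard.Holds ν t ↔ ν 0 - t ∈ I.toSet := by
  cases I <;> simp [beforeGuard, Guard.Holds, Cmp.Holds, toSet]

end TimeInterval

namespace TPTL

variable {α : Type*}

theorem sat_and {ρ : TimedWord α} {φ ψ : TPTL α} {i : Fin ρ.length} {ν : ℕ → ℝ} :
    (and φ ψ).Sat ρ i ν ↔ φ.Sat ρ i ν ∧ ψ.Sat ρ i ν := by
  simp only [and, Sat]
  tauto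

theorem sat_ev {ρ : TimedWord α} {φ : TPTL α} {i : Fin ρ.length} {ν : ℕ → ℝ} :
    (ev φ).Sat ρ i ν ↔ ∃ j, i < j ∧ φ.Sat ρ j ν := by
  simp [ev, Sat]

theorem sat_within {ρ : TimedWord α} {x : ℕ} {i : Fin ρ.length} {ν : ℕ → ℝ} :
    (within x).Sat ρ i ν ↔ ρ.time i - ν x ∈ Set.Ioo (1 : ℝ) 2 := by
  simp only [within, Sat, Guard.Holds, Cmp.Holds, Set.mem_Ioo]
  push_cast
  exact and_congr (by constructor <;> intro <;> linarith) (by constructor <;> intro <;> linarith)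

theorem IsUnaryFuture.and {φ ψ : TPTL α} (hφ : φ.IsUnaryFuture) (hψ : ψ.IsUnaryFuture) :
    (TPTL.and φ ψ).IsUnaryFuture :=
  .neg (.or (.neg hφ) (.neg hψ))

theorem witness_isUnaryFuture (a b c : α) : (witness a b c).IsUnaryFuture :=
  .ev (.freeze _ (.and (.atom _) (.ev (.and (.atom _) (.and (.guard _)
    (.ev (.and (.atom _) (.guard _))))))))

theorem mem_witness_lang {a b c : α} {ρ : TimedWord α} : ρ ∈ (witness a b c).lang ↔
    ∃ i j l : Fin ρ.length, ρ.first < i ∧ i < j ∧ j < l ∧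
      ρ.letter i = a ∧ ρ.letter j = b ∧ ρ.letter l = c ∧
      ρ.time j - ρ.time i ∈ Set.Ioo (1 : ℝ) 2 ∧ ρ.time l - ρ.time i ∈ Set.Ioo (1 : ℝ) 2 := by
  have hfreeze {φ : TPTL α} {i : Fin ρ.length} {ν : ℕ → ℝ} :
      (freeze 0 φ).Sat ρ i ν ↔ φ.Sat ρ i (Function.update ν 0 (ρ.time i)) := Iff.rfl
  have hatom {x : α} {i : Fin ρ.length} {ν : ℕ → ℝ} :
      (atom x).Sat ρ i ν ↔ ρ.letter i = x := Iff.rfl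
  simp only [lang, witness, Set.mem_ofPred_eq, sat_ev, sat_and, hfreeze, hatom, sat_within,
    Function.update_self]
  constructor
  · rintro ⟨i, hi, ha, j, hj, hb, htj, l, hl, hc, htl⟩
    exact ⟨i, j, l, hi, hj, hl, ha, hb, hc, htj, htl⟩
  · rintro ⟨i, j, l, hi, hj, hl, ha, hb, hc, htj, htl⟩
    exact ⟨i, hi, ha, j, hj, hb, htj, l, hl, hc, htl⟩

/-- Every definable language of `TPTL[F]` is definable in `TPTL[U,S]`. -/
theorem languagesF_subset_languages (C : Set (TimedWord α)) : languagesF C ⊆ languages C :=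
  fun _ ⟨φ, _, h⟩ => ⟨φ, h⟩

end TPTL

namespace MTL

variable {α : Type*}

/-- The translation of `MTL[U,S]` into `TPTL[U,S]`. A single freeze variable suffices, because the
translation of a subformula never reads a value frozen outside of it. -/
def toTPTL : MTL α → TPTL α
  | top => .top
  | atom a => .atom a
  | neg φ => .neg (toTPTL φ)
  | and φ ψ => .and (toTPTL φ) (toTPTL ψ)
  | untl I φ ψ => .freeze 0 (.untl (toTPTL φ) (.and (toTPTL ψ) (.guard I.afterGuard)))
  | since I φ ψ => .freeze 0 (.since (toTPTL φ) (.and (toTPTL ψ) (.guard I.beforeGuard)))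

theorem sat_toTPTL {ρ : TimedWord α} (φ : MTL α) (i : Fin ρ.length) (ν : ℕ → ℝ) :
    φ.toTPTL.Sat ρ i ν ↔ φ.Sat ρ i := by
  induction φ generalizing i ν with
  | top => exact Iff.rfl
  | atom a => exact Iff.rfl
  | neg φ ih => exact not_congr (ih i ν)
  | and φ ψ ihφ ihψ => rw [toTPTL, TPTL.sat_and, ihφ, ihψ, Sat]
  | untl I φ ψ ihφ ihψ =>
    simp only [toTPTL, TPTL.Sat, TPTL.sat_and, ihφ, ihψ, Sat, TimeInterval.afterGuard_holds,
      Function.update_self, and_assoc]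
  | since I φ ψ ihφ ihψ =>
    simp only [toTPTL, TPTL.Sat, TPTL.sat_and, ihφ, ihψ, Sat, TimeInterval.beforeGuard_holds,
      Function.update_self, and_assoc]

theorem languages_subset_tptl (C : Set (TimedWord α)) : languages C ⊆ TPTL.languages C := by
  rintro _ ⟨φ, rfl⟩
  refine ⟨φ.toTPTL, ?_⟩
  congr 1
  ext ρ
  exact (sat_toTPTL φ ρ.first _).symm

end MTL

/-! ### The game on codes -/

/-- Codes of the events of a segment word with `m` segments. Code `3 * q + e` with `q ≥ 1` stands for
the `a` of segment `q` (`e = 0`), the `b` of segment `q - 2` (`e = 1`) or the `c` of segment `q - 2`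
(`e = 2`); these three events form the `q`-th *cluster*. Code `0` is the initial `a`. -/
def IsCode (m p : ℕ) : Prop :=
  p = 0 ∨ (p % 3 = 0 ∧ 3 ≤ p ∧ p ≤ 3 * m) ∨ (p % 3 ≠ 0 ∧ 9 ≤ p ∧ p ≤ 3 * m + 8)

/-- The integral part of the time distance between the events coded by `x < y`, for `x ≠ 0`.
The parameter `d` is the code of the `a` of the segment whose `c` has been moved to just before
distance `2`; for the word in which no `c` is moved, `d = 0`. -/
def unitDist (d x y : ℕ) : ℕ :=
  if y / 3 = x / 3 then 0
  else if y % 3 = 2 ∧ ((y / 3 = x / 3 + 1 ∧ x % 3 ≠ 2) ∨ (y = x + 8 ∧ x % 3 = 0 ∧ x ≠ d)) then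
    y / 3 - x / 3
  else y / 3 - x / 3 - 1

/-- What intervals with constants up to `k` observe of the distance between the events coded by
`x < y`: its integral part, capped at `k`. The initial event is further than `k` from all others. -/
def obsDist (k d x y : ℕ) : ℕ :=
  if x = 0 then k else min k (unitDist d x y)

/-- Duplicator's invariant: the two codes agree, or they stand for the same letter and both lie in
the clusters `lo, …, hi`. -/
def CodeSimilar (lo hi x y : ℕ) : Prop :=
  x = y ∨ (x % 3 = y % 3 ∧ (lo ≤ x / 3 ∧ x / 3 ≤ hi) ∧ lo ≤ y / 3 ∧ y / 3 ≤ hi)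

theorem CodeSimilar.symm {lo hi x y : ℕ} (h : CodeSimilar lo hi x y) : CodeSimilar lo hi y x := by
  unfold CodeSimilar at *
  omega

theorem isCode_of_cluster {m p : ℕ} (h : 3 ≤ p / 3 ∧ p / 3 ≤ m) : IsCode m p := by
  unfold IsCode
  omega

section Distances

variable {k X d d' x y x' y' : ℕ}

/-- From `5`, `8` and `11` are the `c`s of the segments
`q - 1`, `q` and `q + 1`. -/
theorem unitDist_add_five (hx : x % 3 = 0) : unitDist d x (x + 5) = 1 := by
  unfold unitDist
  split_ifs <;> omega

theorem unitDist_add_eleven (hx : x % 3 = 0) : unitDist d x (x + 11) = 2 := by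
  unfold unitDist
  split_ifs <;> omega

theorem unitDist_add_eight_self (hd : d % 3 = 0) : unitDist d d (d + 8) = 1 := by
  unfold unitDist
  split_ifs <;> omega

theorem unitDist_add_eight_of_ne (hx : x % 3 = 0) (hd : x ≠ d) : unitDist d x (x + 8) = 2 := by
  unfold unitDist
  split_ifs <;> omega

/-- Distances are invariant under shifting both events by the same number of clusters, unless the
moved `c` and the `a` of its segment are concerned and `k ≥ 2`. -/
theorem obsDist_eq_of_shift (hx : x ≠ 0) (hy : y ≠ 0) (hxx : x < x') (hyy : y' = y + (x' - x))
    (hxy : x % 3 = y % 3)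
    (h1 : ¬ ((x = d ∧ x' = x + 8) ∧ 2 ≤ k)) (h2 : ¬ ((y = d' ∧ y' = y + 8) ∧ 2 ≤ k)) :
    obsDist k d' y y' = obsDist k d x x' := by
  have e1 : y' / 3 = y / 3 + (x' / 3 - x / 3) := by omega
  have e2 : y' % 3 = x' % 3 := by omega
  unfold obsDist
  rw [if_neg hx, if_neg hy]
  unfold unitDist
  split_ifs <;> omega

theorem obsDist_eq_of_far (h : x = 0 ∨ x / 3 + (k + 1) ≤ x' / 3) : obsDist k d x x' = k := by
  unfold obsDist unitDist
  split_ifs <;> omega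

theorem obsDist_eq_of_ne (h : ¬ ((x = 3 * X ∧ x' = x + 8) ∧ 2 ≤ k)) (hd : d = 0 ∨ d = 3 * X)
    (hd' : d' = 0 ∨ d' = 3 * X) : obsDist k d' x x' = obsDist k d x x' := by
  unfold obsDist unitDist
  split_ifs <;> omega

end Distances

/-- The code `y'` is a good answer, with respect to the invariant `CodeSimilar lo hi`, to a move of
Spoiler from `x` to `x' > x` when Duplicator stands at `y`: it preserves the observed distance and
the invariant, it is not adjacent to `y` if `x'` is not adjacent to `x`, and every event between `y`
and `y'` is matched by one between `x` and `x'`. -/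
def UntilAnswer (k m d d' lo hi x x' y y' : ℕ) : Prop :=
  IsCode m y' ∧ y < y' ∧ obsDist k d' y y' = obsDist k d x x' ∧ CodeSimilar lo hi x' y' ∧
    ((∃ z, IsCode m z ∧ x < z ∧ z < x') → ∃ z, IsCode m z ∧ y < z ∧ z < y') ∧
    ∀ y'', IsCode m y'' → y < y'' → y'' < y' →
      ∃ x'', IsCode m x'' ∧ x < x'' ∧ x'' < x' ∧ CodeSimilar lo hi x'' y''

/-- The mirror image of `UntilAnswer`, for a move of Spoiler from `x` to `x' < x`. -/
def SinceAnswer (k m d d' lo hi x x' y y' : ℕ) : Prop :=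
  IsCode m y' ∧ y' < y ∧ obsDist k d' y' y = obsDist k d x' x ∧ CodeSimilar lo hi x' y' ∧
    ((∃ z, IsCode m z ∧ x' < z ∧ z < x) → ∃ z, IsCode m z ∧ y' < z ∧ z < y) ∧
    ∀ y'', IsCode m y'' → y' < y'' → y'' < y →
      ∃ x'', IsCode m x'' ∧ x' < x'' ∧ x'' < x ∧ CodeSimilar lo hi x'' y''

section Moves

variable {k m X d d' lo hi x y x' : ℕ}

/-- From equal positions, Duplicator copies Spoiler's move, unless Spoiler moves from the `a` of the
special segment to its `c`; then the `c` of a neighbouring segment is the answer. -/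
theorem exists_untilAnswer_self (hd : d = 0 ∨ d = 3 * X) (hd' : d' = 0 ∨ d' = 3 * X)
    (hlo : 3 ≤ lo) (hhi : hi ≤ m) (hX : 2 ≤ k → lo + 1 ≤ X ∧ X + 3 ≤ hi) (hxx : x < x')
    (hx' : IsCode m x') : ∃ y', UntilAnswer k m d d' lo hi x x' x y' := by
  by_cases hobs : obsDist k d' x x' = obsDist k d x x'
  · exact ⟨x', hx', hxx, hobs, Or.inl rfl, id, fun y'' h h1 h2 => ⟨y'', h, h1, h2, Or.inl rfl⟩⟩
  obtain ⟨⟨rfl, rfl⟩, hk2⟩ := not_not.1 fun h => hobs (obsDist_eq_of_ne h hd hd')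
  obtain ⟨hX1, hX2⟩ := hX hk2
  have hX0 : 3 * X ≠ 0 := by omega
  have hcode : IsCode m (3 * X + 1) := isCode_of_cluster (by omega)
  rcases hd with rfl | rfl
  -- Spoiler sees integral distance `2`, Duplicator's word has `1` there.
  · refine ⟨3 * X + 11, isCode_of_cluster (by omega), by omega, ?_, Or.inr (by omega),
      fun _ => ⟨_, hcode, by omega, by omega⟩, fun y'' h h1 h2 => ?_⟩
    · rw [obsDist, obsDist, if_neg hX0, if_neg hX0, unitDist_add_eleven (by omega),
        unitDist_add_eight_of_ne (by omega) hX0]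
    · by_cases h3 : y'' < 3 * X + 8
      · exact ⟨y'', h, h1, by omega, Or.inl rfl⟩
      · exact ⟨y'' - 3, isCode_of_cluster (by omega), by omega, by omega, Or.inr (by omega)⟩
  -- Spoiler sees integral distance `1`, Duplicator's word has `2` there.
  · refine ⟨3 * X + 5, isCode_of_cluster (by omega), by omega, ?_, Or.inr (by omega),
      fun _ => ⟨_, hcode, by omega, by omega⟩,
      fun y'' h h1 h2 => ⟨y'', h, h1, by omega, Or.inl rfl⟩⟩
    rw [obsDist, obsDist, if_neg hX0, if_neg hX0, unitDist_add_five (by omega),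
      unitDist_add_eight_self (by omega)]

theorem exists_sinceAnswer_self (hd : d = 0 ∨ d = 3 * X) (hd' : d' = 0 ∨ d' = 3 * X)
    (hlo : 3 ≤ lo) (hhi : hi ≤ m) (hX : 2 ≤ k → lo + 1 ≤ X ∧ X + 3 ≤ hi) (hxx : x' < x)
    (hx' : IsCode m x') : ∃ y', SinceAnswer k m d d' lo hi x x' x y' := by
  by_cases hobs : obsDist k d' x' x = obsDist k d x' x
  · exact ⟨x', hx', hxx, hobs, Or.inl rfl, id, fun y'' h h1 h2 => ⟨y'', h, h1, h2, Or.inl rfl⟩⟩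
  obtain ⟨⟨rfl, rfl⟩, hk2⟩ := not_not.1 fun h => hobs (obsDist_eq_of_ne h hd hd')
  obtain ⟨hX1, hX2⟩ := hX hk2
  have hX0 : 3 * X ≠ 0 := by omega
  have hcode : IsCode m (3 * X + 7) := isCode_of_cluster (by omega)
  rcases hd with rfl | rfl
  · refine ⟨3 * X - 3, isCode_of_cluster (by omega), by omega, ?_, Or.inr (by omega),
      fun _ => ⟨_, hcode, by omega, by omega⟩, fun y'' h h1 h2 => ?_⟩
    · rw [obsDist, obsDist, if_neg (by omega), if_neg hX0,
        unitDist_add_eight_of_ne (by omega) hX0, show 3 * X + 8 = 3 * X - 3 + 11 by omega,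
        unitDist_add_eleven (by omega)]
    · by_cases h3 : 3 * X < y''
      · exact ⟨y'', h, by omega, h2, Or.inl rfl⟩
      · exact ⟨y'' + 3, isCode_of_cluster (by omega), by omega, by omega, Or.inr (by omega)⟩
  · refine ⟨3 * X + 3, isCode_of_cluster (by omega), by omega, ?_, Or.inr (by omega),
      fun _ => ⟨_, hcode, by omega, by omega⟩,
      fun y'' h h1 h2 => ⟨y'', h, by omega, h2, Or.inl rfl⟩⟩
    rw [obsDist, obsDist, if_neg (by omega), if_neg hX0,
      unitDist_add_eight_self (by omega), unitDist_add_five (x := 3 * X + 3) (by omega)]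

/-- From positions of the same letter which lie `k + 1` clusters inside of `lo, …, hi`, Duplicator
answers a short move by the same shift, up to one cluster if the moved `c` is concerned. A long move
is answered by a long move, which leads to the same position if Spoiler has left `lo, …, hi`. -/
theorem exists_untilAnswer_of_mod_eq (hk : 1 ≤ k) (hd : d = 0 ∨ d = 3 * X)
    (hd' : d' = 0 ∨ d' = 3 * X) (hlo : 3 ≤ lo) (hhi : hi ≤ m)
    (hX : 2 ≤ k → lo + 1 ≤ X ∧ X + 3 ≤ hi) (hmod : x % 3 = y % 3)
    (hx : lo + (k + 1) ≤ x / 3 ∧ x / 3 + (k + 1) ≤ hi)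
    (hy : lo + (k + 1) ≤ y / 3 ∧ y / 3 + (k + 1) ≤ hi) (hxx : x < x') (hx' : IsCode m x') :
    ∃ y', UntilAnswer k m d d' lo hi x x' y y' := by
  have hx0 : x ≠ 0 := by omega
  have hy0 : y ≠ 0 := by omega
  have hcode : IsCode m (y + 1) := isCode_of_cluster (by omega)
  by_cases hfar : x / 3 + (k + 1) < x' / 3
  · have hobs : obsDist k d x x' = k := obsDist_eq_of_far (by omega)
    have hbetween : ∀ y'', y < y'' → y'' / 3 ≤ hi →
        ∃ x'', IsCode m x'' ∧ x < x'' ∧ x'' < x' ∧ CodeSimilar lo hi x'' y'' := fun y'' h1 h2 =>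
      ⟨x + 1 + (y'' - y + 2) % 3, isCode_of_cluster (by omega), by omega, by omega,
        Or.inr (by omega)⟩
    -- Outside of `lo, …, hi` the invariant forces Duplicator to go to the same position.
    by_cases hout : hi < x' / 3
    · refine ⟨x', hx', by omega, (obsDist_eq_of_far (by omega)).trans hobs.symm,
        Or.inl rfl,
        fun _ => ⟨y + 1, hcode, by omega, by omega⟩, fun y'' h h1 h2 => ?_⟩
      by_cases h3 : y'' / 3 ≤ hi
      · exact hbetween y'' h1 h3
      · exact ⟨y'', h, by omega, h2, Or.inl rfl⟩
    · exact ⟨3 * (y / 3 + (k + 1)) + x' % 3, isCode_of_cluster (by omega), by omega,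
        (obsDist_eq_of_far (by omega)).trans hobs.symm, Or.inr (by omega),
        fun _ => ⟨y + 1, hcode, by omega, by omega⟩,
        fun y'' h h1 h2 => hbetween y'' h1 (by omega)⟩
  by_cases h1 : (x = d ∧ x' = x + 8) ∧ 2 ≤ k
  · obtain ⟨⟨rfl, rfl⟩, hk2⟩ := h1
    refine ⟨y + 5, isCode_of_cluster (by omega), by omega, ?_, Or.inr (by omega),
      fun _ => ⟨y + 1, hcode, by omega, by omega⟩,
      fun y'' h h1 h2 => ⟨x + (y'' - y), isCode_of_cluster (by omega), by omega, by omega,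
        Or.inr (by omega)⟩⟩
    rw [obsDist, obsDist, if_neg hx0, if_neg hy0, unitDist_add_five (by omega),
      unitDist_add_eight_self (by omega)]
  by_cases h2 : (y = d' ∧ x' = x + 8) ∧ 2 ≤ k
  · obtain ⟨⟨rfl, rfl⟩, hk2⟩ := h2
    obtain ⟨hX1, hX2⟩ := hX hk2
    refine ⟨y + 11, isCode_of_cluster (by omega), by omega, ?_, Or.inr (by omega),
      fun _ => ⟨y + 1, hcode, by omega, by omega⟩, fun y'' h h1 h2 => ?_⟩
    · rw [obsDist, obsDist, if_neg hx0, if_neg hy0, unitDist_add_eleven (by omega),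
        unitDist_add_eight_of_ne (by omega) (by omega)]
    · by_cases h3 : y'' < y + 8
      · exact ⟨x + (y'' - y), isCode_of_cluster (by omega), by omega, by omega, Or.inr (by omega)⟩
      · exact ⟨x + (y'' - y) - 3, isCode_of_cluster (by omega), by omega, by omega,
          Or.inr (by omega)⟩
  exact ⟨y + (x' - x), isCode_of_cluster (by omega), by omega,
    obsDist_eq_of_shift hx0 hy0 hxx rfl hmod h1 (by omega), Or.inr (by omega),
    fun ⟨z, _, hz1, hz2⟩ => ⟨y + (z - x), isCode_of_cluster (by omega), by omega, by omega⟩,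
    fun y'' h h1 h2 => ⟨x + (y'' - y), isCode_of_cluster (by omega), by omega, by omega,
      Or.inr (by omega)⟩⟩

theorem exists_sinceAnswer_of_mod_eq (hk : 1 ≤ k) (hd : d = 0 ∨ d = 3 * X)
    (hd' : d' = 0 ∨ d' = 3 * X) (hlo : 3 ≤ lo) (hhi : hi ≤ m)
    (hX : 2 ≤ k → lo + 1 ≤ X ∧ X + 3 ≤ hi) (hne : x ≠ y) (hmod : x % 3 = y % 3)
    (hx : lo + (k + 1) ≤ x / 3 ∧ x / 3 + (k + 1) ≤ hi)
    (hy : lo + (k + 1) ≤ y / 3 ∧ y / 3 + (k + 1) ≤ hi) (hxx : x' < x) (hx' : IsCode m x') :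
    ∃ y', SinceAnswer k m d d' lo hi x x' y y' := by
  have hcode : IsCode m (y - 1) := isCode_of_cluster (by omega)
  by_cases hfar : x' / 3 + (k + 1) < x / 3
  · have hobs : obsDist k d x' x = k := obsDist_eq_of_far (by omega)
    have hbetween : ∀ y'', y'' < y → lo ≤ y'' / 3 →
        ∃ x'', IsCode m x'' ∧ x' < x'' ∧ x'' < x ∧ CodeSimilar lo hi x'' y'' := fun y'' h1 h2 =>
      ⟨x - 1 - (y - y'' + 2) % 3, isCode_of_cluster (by omega), by omega, by omega,
        Or.inr (by omega)⟩
    by_cases hout : x' / 3 < lo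
    · refine ⟨x', hx', by omega, (obsDist_eq_of_far (by omega)).trans hobs.symm,
        Or.inl rfl,
        fun _ => ⟨y - 1, hcode, by omega, by omega⟩, fun y'' h h1 h2 => ?_⟩
      by_cases h3 : lo ≤ y'' / 3
      · exact hbetween y'' h2 h3
      · exact ⟨y'', h, h1, by omega, Or.inl rfl⟩
    · exact ⟨3 * (y / 3 - (k + 1)) + x' % 3, isCode_of_cluster (by omega), by omega,
        (obsDist_eq_of_far (by omega)).trans hobs.symm, Or.inr (by omega),
        fun _ => ⟨y - 1, hcode, by omega, by omega⟩,
        fun y'' h h1 h2 => hbetween y'' h2 (by omega)⟩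
  have hx0 : x' ≠ 0 := by omega
  by_cases h1 : (x' = d ∧ x = x' + 8) ∧ 2 ≤ k
  · obtain ⟨⟨rfl, rfl⟩, hk2⟩ := h1
    obtain ⟨z, rfl⟩ : ∃ z, y = z + 5 := ⟨y - 5, by omega⟩
    refine ⟨z, isCode_of_cluster (by omega), by omega, ?_, Or.inr (by omega),
      fun _ => ⟨_, hcode, by omega, by omega⟩,
      fun y'' h h1 h2 => ⟨x' + 8 - (z + 5 - y''), isCode_of_cluster (by omega), by omega, by omega,
        Or.inr (by omega)⟩⟩
    rw [obsDist, obsDist, if_neg hx0, if_neg (by omega), unitDist_add_five (by omega),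
      unitDist_add_eight_self (by omega)]
  by_cases h2 : (y = d' + 8 ∧ x = x' + 8 ∧ d' ≠ 0) ∧ 2 ≤ k
  · obtain ⟨⟨hyd, rfl, hd0⟩, hk2⟩ := h2
    obtain ⟨hX1, hX2⟩ := hX hk2
    obtain ⟨z, rfl⟩ : ∃ z, y = z + 11 := ⟨y - 11, by omega⟩
    refine ⟨z, isCode_of_cluster (by omega), by omega, ?_, Or.inr (by omega),
      fun _ => ⟨_, hcode, by omega, by omega⟩, fun y'' h h1 h2 => ?_⟩
    · rw [obsDist, obsDist, if_neg hx0, if_neg (by omega), unitDist_add_eleven (by omega),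
        unitDist_add_eight_of_ne (by omega) (by omega)]
    · by_cases h3 : z + 3 < y''
      · exact ⟨x' + 8 - (z + 11 - y''), isCode_of_cluster (by omega), by omega, by omega,
          Or.inr (by omega)⟩
      · exact ⟨x' + 8 - (z + 11 - y'') + 3, isCode_of_cluster (by omega), by omega, by omega,
          Or.inr (by omega)⟩
  exact ⟨y - (x - x'), isCode_of_cluster (by omega), by omega,
    obsDist_eq_of_shift hx0 (by omega) hxx (by omega) (by omega) h1 (by omega), Or.inr (by omega),
    fun ⟨z, _, hz1, hz2⟩ => ⟨y - (x - z), isCode_of_cluster (by omega), by omega, by omega⟩,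
    fun y'' h h1 h2 => ⟨x - (y - y''), isCode_of_cluster (by omega), by omega, by omega,
      Or.inr (by omega)⟩⟩

end Moves

/-! ### Segment words through codes -/

/-- The letter of the event with code `p`. -/
def codeLetter {α : Type*} (a b c : α) (p : ℕ) : α :=
  if p % 3 = 0 then a else if p % 3 = 1 then b else c

/-- `f` lists the codes of the positions of the word `ρ`: it is increasing, onto the codes of a word
with `m` segments, and compatible with letters and with the integral parts of time distances. Of
distances from the initial event it is only required that they exceed `k`. -/
structure IsEncoding {α : Type*} (a b c : α) (k m d : ℕ) (ρ : TimedWord α)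
    (f : Fin ρ.length → ℕ) : Prop where
  strictMono : StrictMono f
  isCode : ∀ i, IsCode m (f i)
  exists_eq : ∀ p, IsCode m p → ∃ i, f i = p
  letter_eq : ∀ i, ρ.letter i = codeLetter a b c (f i)
  lt_dist : ∀ i j, i < j → f i ≠ 0 → (unitDist d (f i) (f j) : ℝ) < ρ.time j - ρ.time i
  dist_lt : ∀ i j, i < j → f i ≠ 0 → ρ.time j - ρ.time i < (unitDist d (f i) (f j) : ℝ) + 1
  dist_initial : ∀ i j, i < j → f i = 0 → (k : ℝ) < ρ.time j - ρ.time i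

namespace TimeInterval

/-- Intervals with constants up to `k` only observe the integral part, capped at `k`, of a
non-integral distance. -/
theorem mem_toSet_iff_of_lt {k o : ℕ} {I : TimeInterval} (hI : I ∈ upTo k) {t u : ℝ}
    (ht : (o : ℝ) < t ∧ (o < k → t < o + 1)) (hu : (o : ℝ) < u ∧ (o < k → u < o + 1)) :
    t ∈ I.toSet ↔ u ∈ I.toSet := by
  have key : ∀ {t : ℝ}, ((o : ℝ) < t ∧ (o < k → t < o + 1)) → ∀ l : ℕ, l ≤ k →
      ((l : ℝ) ≤ t ↔ l ≤ o) ∧ ((l : ℝ) < t ↔ l ≤ o) ∧ (t ≤ l ↔ o < l) ∧ (t < l ↔ o < l) := by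
    intro t ht l hl
    rcases Nat.lt_or_ge o l with h | h
    · have h1 : t < l := by
        have h2 : ((o + 1 : ℕ) : ℝ) ≤ l := Nat.cast_le.2 h
        push_cast at h2
        linarith [ht.2 (by omega)]
      simp only [h, not_le.2 h, h1, h1.le, not_le.2 h1, not_lt.2 h1.le, and_self]
    · have h1 : (l : ℝ) < t := lt_of_le_of_lt (Nat.cast_le.2 h) ht.1
      simp only [h, not_lt.2 h, h1, h1.le, not_le.2 h1, not_lt.2 h1.le, and_self]
  cases I <;> simp only [upTo, Set.mem_ofPred_eq, BoundedBy] at hI <;>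
    simp only [toSet, Set.mem_Icc, Set.mem_Ico, Set.mem_Ioc, Set.mem_Ioo, Set.mem_Ici, Set.mem_Ioi]
  case ci l => rw [(key ht l hI).1, (key hu l hI).1]
  case oi l => rw [(key ht l hI).2.1, (key hu l hI).2.1]
  all_goals
    simp only [(key ht _ hI.1).1, (key hu _ hI.1).1, (key ht _ hI.1).2.1, (key hu _ hI.1).2.1,
      (key ht _ hI.2).2.2, (key hu _ hI.2).2.2]

end TimeInterval

namespace IsEncoding

variable {α : Type*} {a b c : α} {k m d d' X : ℕ} {ρ σ : TimedWord α} {f : Fin ρ.length → ℕ}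
  {g : Fin σ.length → ℕ}

theorem obsDist_spec (hf : IsEncoding a b c k m d ρ f) {i j : Fin ρ.length} (hij : i < j) :
    (obsDist k d (f i) (f j) : ℝ) < ρ.time j - ρ.time i ∧
      (obsDist k d (f i) (f j) < k → ρ.time j - ρ.time i < obsDist k d (f i) (f j) + 1) := by
  unfold obsDist
  by_cases h0 : f i = 0
  · rw [if_pos h0]
    exact ⟨hf.dist_initial i j hij h0, fun h => absurd h (lt_irrefl _)⟩
  · rw [if_neg h0]
    have h1 := hf.lt_dist i j hij h0
    refine ⟨lt_of_le_of_lt (Nat.cast_le.2 (min_le_right _ _)) h1, fun h => ?_⟩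
    rw [min_eq_right (by omega)]
    exact hf.dist_lt i j hij h0

theorem mem_toSet_iff (hf : IsEncoding a b c k m d ρ f) (hg : IsEncoding a b c k m d' σ g)
    {I : TimeInterval} (hI : I ∈ TimeInterval.upTo k) {i i' : Fin ρ.length} {j j' : Fin σ.length}
    (hi : i < i') (hj : j < j') (h : obsDist k d' (g j) (g j') = obsDist k d (f i) (f i')) :
    ρ.time i' - ρ.time i ∈ I.toSet ↔ σ.time j' - σ.time j ∈ I.toSet :=
  TimeInterval.mem_toSet_iff_of_lt hI (hf.obsDist_spec hi) (h ▸ hg.obsDist_spec hj)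

theorem succ_ne_iff (hf : IsEncoding a b c k m d ρ f) {i i' : Fin ρ.length} (hi : i < i') :
    (i' : ℕ) ≠ i + 1 ↔ ∃ z, IsCode m z ∧ f i < z ∧ z < f i' := by
  rw [Fin.lt_def] at hi
  constructor
  · intro h
    exact ⟨f ⟨i + 1, by omega⟩, hf.isCode _, hf.strictMono (Fin.lt_def.2 (by simp)),
      hf.strictMono (Fin.lt_def.2 (show (i : ℕ) + 1 < i' by omega))⟩
  · rintro ⟨z, hz, h1, h2⟩ h
    obtain ⟨l, rfl⟩ := hf.exists_eq z hz
    rw [hf.strictMono.lt_iff_lt, Fin.lt_def] at h1 h2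
    omega

theorem untilMove (hf : IsEncoding a b c k m d ρ f) (hg : IsEncoding a b c k m d' σ g)
    {lo hi : ℕ} {R : Fin ρ.length → Fin σ.length → Prop}
    (hR : ∀ i j, CodeSimilar lo hi (f i) (g j) → R i j) {i : Fin ρ.length} {j : Fin σ.length}
    (h : ∀ x', IsCode m x' → f i < x' → ∃ y', UntilAnswer k m d d' lo hi (f i) x' (g j) y')
    {I : TimeInterval} (hI : I ∈ TimeInterval.upTo k) : UntilMove ρ σ I R i j := by
  intro i' hii hmem
  obtain ⟨y', hy', hjy, hobs, hsim, hadj, hbetween⟩ :=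
    h (f i') (hf.isCode _) (hf.strictMono hii)
  obtain ⟨j', rfl⟩ := hg.exists_eq y' hy'
  have hjj : j < j' := hg.strictMono.lt_iff_lt.1 hjy
  refine ⟨j', hjj, (hf.mem_toSet_iff hg hI hii hjj hobs).1 hmem, hR _ _ hsim, ?_, ?_⟩
  · rw [← not_iff_not, ← ne_eq, ← ne_eq, hf.succ_ne_iff hii, hg.succ_ne_iff hjj]
    refine ⟨hadj, fun ⟨z, hz, h1, h2⟩ => ?_⟩
    obtain ⟨x'', hx'', h3, h4, -⟩ := hbetween z hz h1 h2
    exact ⟨x'', hx'', h3, h4⟩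
  · intro _ j'' h1 h2
    obtain ⟨x'', hx'', h3, h4, hs⟩ :=
      hbetween (g j'') (hg.isCode _) (hg.strictMono h1) (hg.strictMono h2)
    obtain ⟨i'', rfl⟩ := hf.exists_eq x'' hx''
    exact ⟨i'', hf.strictMono.lt_iff_lt.1 h3, hf.strictMono.lt_iff_lt.1 h4, hR _ _ hs⟩

theorem sinceMove (hf : IsEncoding a b c k m d ρ f) (hg : IsEncoding a b c k m d' σ g)
    {lo hi : ℕ} {R : Fin ρ.length → Fin σ.length → Prop}
    (hR : ∀ i j, CodeSimilar lo hi (f i) (g j) → R i j) {i : Fin ρ.length} {j : Fin σ.length}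
    (h : ∀ x', IsCode m x' → x' < f i → ∃ y', SinceAnswer k m d d' lo hi (f i) x' (g j) y')
    {I : TimeInterval} (hI : I ∈ TimeInterval.upTo k) : SinceMove ρ σ I R i j := by
  intro i' hii hmem
  obtain ⟨y', hy', hjy, hobs, hsim, hadj, hbetween⟩ :=
    h (f i') (hf.isCode _) (hf.strictMono hii)
  obtain ⟨j', rfl⟩ := hg.exists_eq y' hy'
  have hjj : j' < j := hg.strictMono.lt_iff_lt.1 hjy
  refine ⟨j', hjj, (hf.mem_toSet_iff hg hI hii hjj hobs).1 hmem, hR _ _ hsim, ?_, ?_⟩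
  · rw [← not_iff_not, ← ne_eq, ← ne_eq, hf.succ_ne_iff hii, hg.succ_ne_iff hjj]
    refine ⟨hadj, fun ⟨z, hz, h1, h2⟩ => ?_⟩
    obtain ⟨x'', hx'', h3, h4, -⟩ := hbetween z hz h1 h2
    exact ⟨x'', hx'', h3, h4⟩
  · intro _ j'' h1 h2
    obtain ⟨x'', hx'', h3, h4, hs⟩ :=
      hbetween (g j'') (hg.isCode _) (hg.strictMono h1) (hg.strictMono h2)
    obtain ⟨i'', rfl⟩ := hf.exists_eq x'' hx''
    exact ⟨i'', hf.strictMono.lt_iff_lt.1 h3, hf.strictMono.lt_iff_lt.1 h4, hR _ _ hs⟩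

/-- Duplicator can answer every move so that the invariant shrinks by `k + 1` clusters on each
side. -/
theorem moves_of_codeSimilar (hf : IsEncoding a b c k m d ρ f) (hg : IsEncoding a b c k m d' σ g)
    (hk : 1 ≤ k) (hd : d = 0 ∨ d = 3 * X) (hd' : d' = 0 ∨ d' = 3 * X) {lo hi lo' hi' : ℕ}
    (hlo : 3 ≤ lo) (hhi : hi ≤ m) (hlo' : lo + (k + 1) ≤ lo') (hhi' : hi' + (k + 1) ≤ hi)
    (hX : 2 ≤ k → lo + 1 ≤ X ∧ X + 3 ≤ hi) {R : Fin ρ.length → Fin σ.length → Prop}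
    (hR : ∀ i j, CodeSimilar lo hi (f i) (g j) → R i j) {i : Fin ρ.length} {j : Fin σ.length}
    (h : CodeSimilar lo' hi' (f i) (g j)) {I : TimeInterval} (hI : I ∈ TimeInterval.upTo k) :
    UntilMove ρ σ I R i j ∧ SinceMove ρ σ I R i j := by
  constructor
  · refine hf.untilMove hg hR (fun x' hx' hxx => ?_) hI
    by_cases hne : f i = g j
    · rw [← hne]
      exact exists_untilAnswer_self hd hd' hlo hhi hX hxx hx'
    · have h := h.resolve_left hne
      exact exists_untilAnswer_of_mod_eq hk hd hd' hlo hhi hX h.1 (by omega) (by omega) hxx hx'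
  · refine hf.sinceMove hg hR (fun x' hx' hxx => ?_) hI
    by_cases hne : f i = g j
    · rw [← hne]
      exact exists_sinceAnswer_self hd hd' hlo hhi hX hxx hx'
    · have h := h.resolve_left hne
      exact exists_sinceAnswer_of_mod_eq hk hd hd' hlo hhi hX hne h.1 (by omega) (by omega) hxx hx'

theorem letter_eq_of_codeSimilar (hf : IsEncoding a b c k m d ρ f)
    (hg : IsEncoding a b c k m d' σ g) {lo hi : ℕ} {i : Fin ρ.length} {j : Fin σ.length}
    (h : CodeSimilar lo hi (f i) (g j)) : ρ.letter i = σ.letter j := by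
  have hmod : f i % 3 = g j % 3 := h.elim (fun h => by rw [h]) And.left
  rw [hf.letter_eq, hg.letter_eq, codeLetter, codeLetter, hmod]

/-- With `r ≤ n` rounds left, Duplicator wins from similar codes which lie at least `r * (k + 1)`
clusters inside of the range `3, …, m` of complete clusters. -/
theorem duplicatorWinsFrom {n : ℕ} (hf : IsEncoding a b c k (segCount n k) d ρ f)
    (hg : IsEncoding a b c k (segCount n k) d' σ g) (hk : 1 ≤ k)
    (hd : d = 0 ∨ d = 3 * segMid n k) (hd' : d' = 0 ∨ d' = 3 * segMid n k) (r : ℕ) (hr : r ≤ n)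
    (i : Fin ρ.length) (j : Fin σ.length)
    (h : CodeSimilar (3 + r * (k + 1)) (segCount n k - r * (k + 1)) (f i) (g j)) :
    DuplicatorWinsFrom (TimeInterval.upTo k) ρ σ r i j := by
  induction r generalizing i j with
  | zero => exact hf.letter_eq_of_codeSimilar hg h
  | succ r ih =>
    have hlt : (r + 1) * (k + 1) ≤ n * (k + 1) := Nat.mul_le_mul_right _ hr
    have hm : segCount n k = 2 * (n * (k + 1)) + 1 := by rw [segCount, mul_assoc]
    have hX : segMid n k = n * (k + 1) + 1 := rfl
    rw [Nat.succ_mul] at h hlt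
    have hR := fun i j h => ih (by omega) i j h
    refine ⟨hf.letter_eq_of_codeSimilar hg h, fun I hI => ?_⟩
    obtain ⟨h1, h2⟩ := hf.moves_of_codeSimilar hg hk hd hd' (by omega) (by omega) (by omega)
      (by omega) (by omega) hR h hI
    obtain ⟨h3, h4⟩ := hg.moves_of_codeSimilar hf hk hd' hd (by omega) (by omega) (by omega)
      (by omega) (by omega) (fun j i h => hR i j h.symm) h.symm hI
    exact ⟨h1, h3, h2, h4⟩

theorem first_eq_zero (hf : IsEncoding a b c k m d ρ f) : f ρ.first = 0 := by
  obtain ⟨i, hi⟩ := hf.exists_eq 0 (Or.inl rfl)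
  have h : f ρ.first ≤ f i := hf.strictMono.monotone (Fin.le_def.2 (Nat.zero_le _))
  omega

theorem duplicatorWins {n : ℕ} (hf : IsEncoding a b c k (segCount n k) d ρ f)
    (hg : IsEncoding a b c k (segCount n k) d' σ g) (hk : 1 ≤ k)
    (hd : d = 0 ∨ d = 3 * segMid n k) (hd' : d' = 0 ∨ d' = 3 * segMid n k) :
    DuplicatorWins (TimeInterval.upTo k) n ρ σ :=
  hf.duplicatorWinsFrom hg hk hd hd' n le_rfl _ _
    (Or.inl (by rw [hf.first_eq_zero, hg.first_eq_zero]))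

theorem time_sub_mem_Ioo_iff (hf : IsEncoding a b c k m d ρ f) {i j : Fin ρ.length} (hij : i < j)
    (hi : f i ≠ 0) : ρ.time j - ρ.time i ∈ Set.Ioo (1 : ℝ) 2 ↔ unitDist d (f i) (f j) = 1 := by
  have h1 := hf.lt_dist i j hij hi
  have h2 := hf.dist_lt i j hij hi
  constructor
  · rintro ⟨h3, h4⟩
    have h5 : ((unitDist d (f i) (f j) : ℕ) : ℝ) < (2 : ℕ) := by push_cast; linarith
    have h6 : ((1 : ℕ) : ℝ) < ((unitDist d (f i) (f j) + 1 : ℕ) : ℝ) := by push_cast; linarith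
    rw [Nat.cast_lt] at h5 h6
    omega
  · intro h
    rw [h] at h1 h2
    norm_num at h1 h2
    exact ⟨h1, h2⟩

/-- The `b` and the moved `c` of the special segment, seen from its `a`, satisfy the witness
formula. -/
theorem mem_witness_lang (hf : IsEncoding a b c k m (3 * X) ρ f) (hX1 : 1 ≤ X) (hX : X ≤ m) :
    ρ ∈ (TPTL.witness a b c).lang := by
  rw [TPTL.mem_witness_lang]
  obtain ⟨i, hi⟩ := hf.exists_eq (3 * X) (by unfold IsCode; omega)
  obtain ⟨j, hj⟩ := hf.exists_eq (3 * X + 7) (by unfold IsCode; omega)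
  obtain ⟨l, hl⟩ := hf.exists_eq (3 * X + 8) (by unfold IsCode; omega)
  have hij : i < j := hf.strictMono.lt_iff_lt.1 (by omega)
  have hjl : j < l := hf.strictMono.lt_iff_lt.1 (by omega)
  refine ⟨i, j, l, hf.strictMono.lt_iff_lt.1 (by rw [hf.first_eq_zero]; omega), hij, hjl,
    ?_, ?_, ?_, ?_, ?_⟩
  · rw [hf.letter_eq, codeLetter, if_pos (by omega)]
  · rw [hf.letter_eq, codeLetter, if_neg (by omega), if_pos (by omega)]
  · rw [hf.letter_eq, codeLetter, if_neg (by omega), if_neg (by omega)]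
  · rw [hf.time_sub_mem_Ioo_iff hij (by omega), hi, hj]
    unfold unitDist
    split_ifs <;> omega
  · rw [hf.time_sub_mem_Ioo_iff (hij.trans hjl) (by omega), hi, hl]
    exact unitDist_add_eight_self (by omega)

theorem notMem_witness_lang (hab : a ≠ b) (hac : a ≠ c) (hbc : b ≠ c)
    (hf : IsEncoding a b c k m 0 ρ f) : ρ ∉ (TPTL.witness a b c).lang := by
  rw [TPTL.mem_witness_lang]
  rintro ⟨i, j, l, hi, hij, hjl, ha, hb, hc, htj, htl⟩
  have hi0 : f i ≠ 0 := by
    have := hf.strictMono hi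
    omega
  have hjl' := hf.strictMono hjl
  rw [hf.time_sub_mem_Ioo_iff hij hi0] at htj
  rw [hf.time_sub_mem_Ioo_iff (hij.trans hjl) hi0] at htl
  rw [hf.letter_eq, codeLetter] at ha hb hc
  have ha' : f i % 3 = 0 := by
    split_ifs at ha with h1 h2
    · exact h1
    · exact absurd ha.symm hab
    · exact absurd ha.symm hac
  have hb' : f j % 3 = 1 := by
    split_ifs at hb with h1 h2
    · exact absurd hb hab
    · exact h2
    · exact absurd hb.symm hbc
  have hc' : f l % 3 = 2 := by
    split_ifs at hc with h1 h2
    · exact absurd hc hac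
    · exact absurd hc hbc
    · omega
  unfold unitDist at htj htl
  split_ifs at htj htl <;> omega

end IsEncoding

/-! ### Time stamps of segment words -/

theorem segStart_add (n k : ℕ) (s : ℝ) (i e : ℕ) :
    segStart n k s (i + e) = segStart n k s i + (e - e * segDelta n k) := by
  unfold segStart
  push_cast
  ring

theorem segDelta_pos (n k : ℕ) : 0 < segDelta n k := by
  unfold segDelta segCount
  positivity

theorem segCount_mul_segDelta (n k : ℕ) : (segCount n k : ℝ) * segDelta n k = 1 / 2 := by
  have : (segCount n k : ℝ) ≠ 0 := by
    unfold segCount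
    positivity
  unfold segDelta
  field_simp

theorem five_le_segCount {n k : ℕ} (hn : 0 < n) (hk : 0 < k) : 5 ≤ segCount n k := by
  have : 1 * 2 ≤ n * (k + 1) := Nat.mul_le_mul hn (by omega)
  rw [segCount, mul_assoc]
  omega

theorem segDelta_le {n k : ℕ} (hn : 0 < n) (hk : 0 < k) : segDelta n k ≤ 1 / 10 := by
  have h1 : ((5 : ℕ) : ℝ) ≤ segCount n k := Nat.cast_le.2 (five_le_segCount hn hk)
  push_cast at h1
  nlinarith [segCount_mul_segDelta n k, segDelta_pos n k]

theorem segMid_bounds {n k : ℕ} : 1 ≤ segMid n k ∧ segMid n k ≤ segCount n k := by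
  rw [segMid, segCount, mul_assoc]
  omega

/-- The time stamp of the event with code `p`. -/
noncomputable def codeTime (n k : ℕ) (s : ℝ) (β γ : ℕ → ℝ) (p : ℕ) : ℝ :=
  if p = 0 then 0
  else if p % 3 = 0 then segStart n k s (p / 3)
  else if p % 3 = 1 then β (p / 3 - 2)
  else γ (p / 3 - 2)

theorem segEvents_eq_image {α : Type*} (a b c : α) (n k : ℕ) (s : ℝ) (β γ : ℕ → ℝ) :
    segEvents a b c n k s β γ =
      (fun p => (codeLetter a b c p, codeTime n k s β γ p)) '' {p | IsCode (segCount n k) p} := by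
  ext e
  simp only [segEvents, Set.mem_ofPred_eq, Set.mem_image]
  constructor
  · rintro (rfl | ⟨i, h1, h2, rfl | rfl | rfl⟩)
    · exact ⟨0, Or.inl rfl, by simp [codeLetter, codeTime]⟩
    · refine ⟨3 * i, by unfold IsCode; omega, ?_⟩
      rw [codeLetter, codeTime, if_pos (by omega), if_neg (by omega), if_pos (by omega),
        show 3 * i / 3 = i by omega]
    · refine ⟨3 * i + 7, by unfold IsCode; omega, ?_⟩
      rw [codeLetter, codeTime, if_neg (by omega), if_pos (by omega), if_neg (by omega),
        if_neg (by omega), if_pos (by omega), show (3 * i + 7) / 3 - 2 = i by omega]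
    · refine ⟨3 * i + 8, by unfold IsCode; omega, ?_⟩
      rw [codeLetter, codeTime, if_neg (by omega), if_neg (by omega), if_neg (by omega),
        if_neg (by omega), if_neg (by omega), show (3 * i + 8) / 3 - 2 = i by omega]
  · rintro ⟨p, hp, rfl⟩
    unfold IsCode at hp
    unfold codeLetter codeTime
    split_ifs with h1 h2 h3
    · exact Or.inl rfl
    · exact Or.inr ⟨p / 3, by omega, by omega, Or.inl rfl⟩
    · omega
    · exact Or.inr ⟨p / 3 - 2, by omega, by omega, Or.inr (Or.inl rfl)⟩
    · omega
    · exact Or.inr ⟨p / 3 - 2, by omega, by omega, Or.inr (Or.inr rfl)⟩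

/-- The constraints on the time stamps of a segment word, in which the `c` of the segment whose `a`
has code `d` (of no segment, if `d = 0`) has been moved to just before distance `2`. -/
structure SegmentTimes (n k d : ℕ) (ε s : ℝ) (β γ : ℕ → ℝ) : Prop where
  eps_pos : 0 < ε
  eps_lt : 4 * ε < segDelta n k
  start_ge : (k : ℝ) + 1 ≤ s
  mod_three : d % 3 = 0
  b_mem : ∀ i, 1 ≤ i → i ≤ segCount n k →
    β i ∈ Set.Ioo (segStart n k s i + 2 - 2 * segDelta n k + 2 * ε)
      (segStart n k s i + 2 - segDelta n k - 2 * ε)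
  c_mem : ∀ i, 1 ≤ i → i ≤ segCount n k → 3 * i ≠ d →
    γ i ∈ Set.Ioo (segStart n k s i + 2) (segStart n k s i + 2 + ε)
  moved_mem : ∀ i, 1 ≤ i → i ≤ segCount n k → 3 * i = d →
    γ i ∈ Set.Ioo (segStart n k s i + 2 - ε) (segStart n k s i + 2)

namespace SegmentTimes

variable {n k d : ℕ} {ε s : ℝ} {β γ : ℕ → ℝ}

theorem codeTime_a {p : ℕ} (hp : p ≠ 0) (h0 : p % 3 = 0) :
    codeTime n k s β γ p = segStart n k s (p / 3) := by
  rw [codeTime, if_neg hp, if_pos h0]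

theorem codeTime_b (h : SegmentTimes n k d ε s β γ) {p : ℕ} (hp : IsCode (segCount n k) p)
    (h1 : p % 3 = 1) : segStart n k s (p / 3) + 2 * ε < codeTime n k s β γ p ∧
      codeTime n k s β γ p < segStart n k s (p / 3) + segDelta n k - 2 * ε := by
  unfold IsCode at hp
  obtain ⟨q, hq⟩ : ∃ q, p / 3 = q + 2 := ⟨p / 3 - 2, by omega⟩
  rw [codeTime, if_neg (by omega), if_neg (by omega), if_pos h1, hq, segStart_add]
  obtain ⟨h2, h3⟩ := h.b_mem q (by omega) (by omega)
  rw [Nat.add_sub_cancel]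
  push_cast
  constructor <;> linarith

theorem codeTime_c (h : SegmentTimes n k d ε s β γ) {p : ℕ} (hp : IsCode (segCount n k) p)
    (h2 : p % 3 = 2) (hd : p ≠ d + 8) :
    segStart n k s (p / 3) + 2 * segDelta n k < codeTime n k s β γ p ∧
      codeTime n k s β γ p < segStart n k s (p / 3) + 2 * segDelta n k + ε := by
  have := h.mod_three
  unfold IsCode at hp
  obtain ⟨q, hq⟩ : ∃ q, p / 3 = q + 2 := ⟨p / 3 - 2, by omega⟩
  rw [codeTime, if_neg (by omega), if_neg (by omega), if_neg (by omega), hq, segStart_add]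
  obtain ⟨h2, h3⟩ := h.c_mem q (by omega) (by omega) (by omega)
  rw [Nat.add_sub_cancel]
  push_cast
  constructor <;> linarith

theorem codeTime_moved (h : SegmentTimes n k d ε s β γ) {p : ℕ} (hp : IsCode (segCount n k) p)
    (hd : p = d + 8) :
    segStart n k s (p / 3) + 2 * segDelta n k - ε < codeTime n k s β γ p ∧
      codeTime n k s β γ p < segStart n k s (p / 3) + 2 * segDelta n k := by
  have := h.mod_three
  unfold IsCode at hp
  obtain ⟨q, hq⟩ : ∃ q, p / 3 = q + 2 := ⟨p / 3 - 2, by omega⟩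
  rw [codeTime, if_neg (by omega), if_neg (by omega), if_neg (by omega), hq, segStart_add]
  obtain ⟨h2, h3⟩ := h.moved_mem q (by omega) (by omega) (by omega)
  rw [Nat.add_sub_cancel]
  push_cast
  constructor <;> linarith

/-- The offset of an event from the start of its cluster. -/
theorem offset_spec (h : SegmentTimes n k d ε s β γ) {p : ℕ} (hp : IsCode (segCount n k) p)
    (hp0 : p ≠ 0) : ∃ u, codeTime n k s β γ p = segStart n k s (p / 3) + u ∧
      ((p % 3 = 0 ∧ u = 0) ∨ (p % 3 = 1 ∧ 2 * ε < u ∧ u < segDelta n k - 2 * ε) ∨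
        ((p % 3 = 2 ∧ p ≠ d + 8) ∧ 2 * segDelta n k < u ∧ u < 2 * segDelta n k + ε) ∨
        ((p % 3 = 2 ∧ p = d + 8) ∧ 2 * segDelta n k - ε < u ∧ u < 2 * segDelta n k)) := by
  refine ⟨codeTime n k s β γ p - segStart n k s (p / 3), by ring, ?_⟩
  obtain h0 | h1 | h2 : p % 3 = 0 ∨ p % 3 = 1 ∨ p % 3 = 2 := by omega
  · exact Or.inl ⟨h0, by rw [codeTime_a hp0 h0, sub_self]⟩
  · obtain ⟨h2, h3⟩ := h.codeTime_b hp h1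
    exact Or.inr (Or.inl ⟨h1, by linarith, by linarith⟩)
  · by_cases hd : p = d + 8
    · obtain ⟨h3, h4⟩ := h.codeTime_moved hp hd
      exact Or.inr (Or.inr (Or.inr ⟨⟨h2, hd⟩, by linarith, by linarith⟩))
    · obtain ⟨h3, h4⟩ := h.codeTime_c hp h2 hd
      exact Or.inr (Or.inr (Or.inl ⟨⟨h2, hd⟩, by linarith, by linarith⟩))

/-- `unitDist` is the integral part of the distance: over the whole word the segments drift by
`(segCount n k) * δ = 1 / 2` only, which leaves room for the offsets inside of the clusters. -/
theorem unitDist_spec (h : SegmentTimes n k d ε s β γ) (hn : 0 < n) (hk : 0 < k) {x y : ℕ}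
    (hx : IsCode (segCount n k) x) (hy : IsCode (segCount n k) y) (hx0 : x ≠ 0) (hxy : x < y) :
    (unitDist d x y : ℝ) < codeTime n k s β γ y - codeTime n k s β γ x ∧
      codeTime n k s β γ y - codeTime n k s β γ x < (unitDist d x y : ℝ) + 1 := by
  have hδ := segDelta_pos n k
  have hδ' := segDelta_le hn hk
  have hε := h.eps_pos
  have hε' := h.eps_lt
  have hd3 := h.mod_three
  obtain ⟨e, he⟩ : ∃ e, y / 3 = x / 3 + e := ⟨y / 3 - x / 3, by omega⟩
  have hdrift : (e : ℝ) * segDelta n k ≤ 1 / 2 + segDelta n k := by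
    have h1 : (e : ℝ) ≤ ((segCount n k + 1 : ℕ) : ℝ) :=
      Nat.cast_le.2 (by unfold IsCode at hx hy; omega)
    push_cast at h1
    have h2 := mul_le_mul_of_nonneg_right h1 hδ.le
    linarith [segCount_mul_segDelta n k]
  obtain ⟨u, hu, hxu⟩ := h.offset_spec hx hx0
  obtain ⟨v, hv, hyv⟩ := h.offset_spec hy (by omega)
  rw [hu, hv, he, segStart_add, show segStart n k s (x / 3) + (e - e * segDelta n k) + v -
    (segStart n k s (x / 3) + u) = e - e * segDelta n k + (v - u) by ring]
  obtain rfl | rfl | rfl | h3 : e = 0 ∨ e = 1 ∨ e = 2 ∨ 3 ≤ e := by omega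
  · have hval : unitDist d x y = 0 := by
      unfold unitDist
      split_ifs <;> omega
    rw [hval]
    push_cast
    rcases hxu with ⟨h1, h2⟩ | ⟨h1, h2, h3⟩ | ⟨h1, h2, h3⟩ | ⟨h1, h2, h3⟩ <;>
    rcases hyv with ⟨h4, h5⟩ | ⟨h4, h5, h6⟩ | ⟨h4, h5, h6⟩ | ⟨h4, h5, h6⟩ <;>
    first
      | omega
      | constructor <;> linarith
  · have hval : unitDist d x y = if y % 3 = 2 ∧ x % 3 ≠ 2 then 1 else 0 := by
      unfold unitDist
      split_ifs <;> omega
    rw [hval]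
    rcases hxu with ⟨h1, h2⟩ | ⟨h1, h2, h3⟩ | ⟨h1, h2, h3⟩ | ⟨h1, h2, h3⟩ <;>
    rcases hyv with ⟨h4, h5⟩ | ⟨h4, h5, h6⟩ | ⟨h4, h5, h6⟩ | ⟨h4, h5, h6⟩ <;>
    first
      | omega
      | (rw [if_pos (by omega)]; push_cast; constructor <;> linarith)
      | (rw [if_neg (by omega)]; push_cast; constructor <;> linarith)
  · have hval : unitDist d x y = if y % 3 = 2 ∧ x % 3 = 0 ∧ y ≠ d + 8 then 2 else 1 := by
      unfold unitDist
      split_ifs <;> omega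
    rw [hval]
    rcases hxu with ⟨h1, h2⟩ | ⟨h1, h2, h3⟩ | ⟨h1, h2, h3⟩ | ⟨h1, h2, h3⟩ <;>
    rcases hyv with ⟨h4, h5⟩ | ⟨h4, h5, h6⟩ | ⟨h4, h5, h6⟩ | ⟨h4, h5, h6⟩ <;>
    first
      | omega
      | (rw [if_pos (by omega)]; push_cast; constructor <;> linarith)
      | (rw [if_neg (by omega)]; push_cast; constructor <;> linarith)
  · obtain ⟨q, rfl⟩ : ∃ q, e = q + 1 := ⟨e - 1, by omega⟩
    have hval : unitDist d x y = q := by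
      unfold unitDist
      split_ifs <;> omega
    have h4 : ((3 : ℕ) : ℝ) * segDelta n k ≤ ((q + 1 : ℕ) : ℝ) * segDelta n k :=
      mul_le_mul_of_nonneg_right (Nat.cast_le.2 h3) hδ.le
    have hu1 : 0 ≤ u ∧ u < 2 * segDelta n k + ε := by
      rcases hxu with ⟨h1, h2⟩ | ⟨h1, h2, h3⟩ | ⟨h1, h2, h3⟩ | ⟨h1, h2, h3⟩ <;>
        constructor <;> linarith
    have hv1 : 0 ≤ v ∧ v < 2 * segDelta n k + ε := by
      rcases hyv with ⟨h1, h2⟩ | ⟨h1, h2, h3⟩ | ⟨h1, h2, h3⟩ | ⟨h1, h2, h3⟩ <;>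
        constructor <;> linarith
    rw [hval]
    push_cast at h4 hdrift ⊢
    constructor <;> linarith

theorem lt_codeTime (h : SegmentTimes n k d ε s β γ) (hn : 0 < n) (hk : 0 < k) {y : ℕ}
    (hy : IsCode (segCount n k) y) (hy0 : y ≠ 0) : (k : ℝ) < codeTime n k s β γ y := by
  have h3 : IsCode (segCount n k) 3 := by
    have := five_le_segCount hn hk
    unfold IsCode
    omega
  have hs : codeTime n k s β γ 3 = s := by
    rw [codeTime_a (by omega) (by omega), segStart]
    norm_num
  have hks := h.start_ge
  rcases (show y = 3 ∨ 3 < y by unfold IsCode at hy; omega) with rfl | hlt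
  · linarith
  · have h1 := (h.unitDist_spec hn hk h3 hy (by omega) hlt).1
    have h2 : (0 : ℝ) ≤ unitDist d 3 y := Nat.cast_nonneg _
    linarith

theorem strictMonoOn_codeTime (h : SegmentTimes n k d ε s β γ) (hn : 0 < n) (hk : 0 < k) :
    StrictMonoOn (codeTime n k s β γ) {p | IsCode (segCount n k) p} := by
  intro x hx y hy hxy
  by_cases hx0 : x = 0
  · have h1 := h.lt_codeTime hn hk hy (by omega)
    have h2 : (0 : ℝ) ≤ k := Nat.cast_nonneg _
    rw [hx0, codeTime, if_pos rfl]
    linarith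
  · have h1 := (h.unitDist_spec hn hk hx hy hx0 hxy).1
    have h2 : (0 : ℝ) ≤ unitDist d x y := Nat.cast_nonneg _
    linarith

theorem exists_isEncoding {α : Type*} {a b c : α} {ρ : TimedWord α}
    (h : SegmentTimes n k d ε s β γ) (hn : 0 < n) (hk : 0 < k)
    (hρ : ρ.HasEvents (segEvents a b c n k s β γ)) :
    ∃ f, IsEncoding a b c k (segCount n k) d ρ f := by
  obtain ⟨hstrict, hrange⟩ := hρ
  rw [segEvents_eq_image] at hrange
  have hmono := h.strictMonoOn_codeTime hn hk
  have hex : ∀ i, ∃ p, IsCode (segCount n k) p ∧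
      codeLetter a b c p = ρ.letter i ∧ codeTime n k s β γ p = ρ.time i := fun i => by
    obtain ⟨p, hp, he⟩ := hrange.subset (Set.mem_range_self i)
    exact ⟨p, hp, congrArg Prod.fst he, congrArg Prod.snd he⟩
  choose f hcode hletter htime using hex
  have hf : StrictMono f := fun i j hij =>
    (hmono.lt_iff_lt (hcode i) (hcode j)).1 (by rw [htime, htime]; exact hstrict hij)
  refine ⟨f, hf, hcode, fun p hp => ?_, fun i => (hletter i).symm, fun i j hij hi => ?_,
    fun i j hij hi => ?_, fun i j hij hi => ?_⟩
  · obtain ⟨i, hi⟩ := hrange.superset (Set.mem_image_of_mem _ hp)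
    exact ⟨i, hmono.injOn (hcode i) hp ((htime i).trans (congrArg Prod.snd hi))⟩
  · rw [← htime, ← htime]
    exact (h.unitDist_spec hn hk (hcode i) (hcode j) hi (hf hij)).1
  · rw [← htime, ← htime]
    exact (h.unitDist_spec hn hk (hcode i) (hcode j) hi (hf hij)).2
  · have hj := hf hij
    rw [← htime, ← htime, hi]
    rw [show codeTime n k s β γ 0 = 0 from if_pos rfl, sub_zero]
    exact h.lt_codeTime hn hk (hcode j) (by omega)

/-- A segment word is obtained by listing its codes in increasing order. -/
theorem exists_hasEvents {α : Type*} (a b c : α) (h : SegmentTimes n k d ε s β γ) (hn : 0 < n)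
    (hk : 0 < k) : ∃ ρ : TimedWord α, ρ.HasEvents (segEvents a b c n k s β γ) := by
  classical
  have hmono := h.strictMonoOn_codeTime hn hk
  let P : Finset ℕ := (Finset.range (3 * segCount n k + 9)).filter (IsCode (segCount n k))
  have hP : ∀ p, p ∈ P ↔ IsCode (segCount n k) p := fun p => by
    rw [Finset.mem_filter, Finset.mem_range]
    exact ⟨And.right, fun hp => ⟨by unfold IsCode at hp; omega, hp⟩⟩
  have h0 : (0 : ℕ) ∈ P := (hP 0).2 (Or.inl rfl)
  let f : Fin P.card ↪o ℕ := P.orderEmbOfFin rfl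
  have hf : ∀ i, IsCode (segCount n k) (f i) := fun i => (hP _).1 (P.orderEmbOfFin_mem rfl i)
  have hpos : 0 < P.card := Finset.card_pos.2 ⟨0, h0⟩
  have hstrict : StrictMono fun i => codeTime n k s β γ (f i) := fun i j hij =>
    hmono (hf i) (hf j) (f.strictMono hij)
  have hsurj : ∀ p, IsCode (segCount n k) p → ∃ i, f i = p := fun p hp => by
    have : p ∈ Set.range f := by
      rw [Finset.range_orderEmbOfFin]
      exact (hP p).2 hp
    exact this
  refine ⟨⟨P.card, hpos, fun i => codeLetter a b c (f i), fun i => codeTime n k s β γ (f i),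
    hstrict.monotone, ?_⟩, hstrict, ?_⟩
  · obtain ⟨i, hi⟩ := hsurj 0 (Or.inl rfl)
    have h1 : f ⟨0, hpos⟩ ≤ f i := f.monotone (Fin.le_def.2 (Nat.zero_le _))
    rw [show f ⟨0, hpos⟩ = 0 by omega]
    exact if_pos rfl
  · rw [segEvents_eq_image]
    ext e
    constructor
    · rintro ⟨i, rfl⟩
      exact ⟨f i, hf i, rfl⟩
    · rintro ⟨p, hp, rfl⟩
      obtain ⟨i, rfl⟩ := hsurj p hp
      exact ⟨i, rfl⟩

end SegmentTimes

/-! ### Segment pairs -/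

section Pairs

variable {α : Type*} {a b c : α} {n k : ℕ} {A B : TimedWord α}

theorem segmentTimes_of_bounds {ε s : ℝ} {β γ : ℕ → ℝ} (hε : 0 < ε) (hε' : 4 * ε < segDelta n k)
    (hs : (k : ℝ) + 1 ≤ s)
    (h : ∀ i, 1 ≤ i → i ≤ segCount n k →
      β i ∈ Set.Ioo (segStart n k s i + 2 - 2 * segDelta n k + 2 * ε)
        (segStart n k s i + 2 - segDelta n k - 2 * ε) ∧
      γ i ∈ Set.Ioo (segStart n k s i + 2) (segStart n k s i + 2 + ε)) :
    SegmentTimes n k 0 ε s β γ :=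
  ⟨hε, hε', hs, rfl, fun i h1 h2 => (h i h1 h2).1, fun i h1 h2 _ => (h i h1 h2).2,
    fun i h1 _ h3 => by omega⟩

theorem SegmentTimes.update {ε s : ℝ} {β γ : ℕ → ℝ} {γ' : ℝ} (h : SegmentTimes n k 0 ε s β γ)
    (hγ' : γ' ∈ Set.Ioo (segStart n k s (segMid n k) + 2 - ε) (segStart n k s (segMid n k) + 2)) :
    SegmentTimes n k (3 * segMid n k) ε s β (Function.update γ (segMid n k) γ') := by
  refine ⟨h.eps_pos, h.eps_lt, h.start_ge, by omega, h.b_mem, fun i h1 h2 h3 => ?_,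
    fun i _ _ h3 => ?_⟩
  · rw [Function.update_of_ne (by omega)]
    exact h.c_mem i h1 h2 (by omega)
  · obtain rfl : i = segMid n k := by omega
    rw [Function.update_self]
    exact hγ'

theorem IsSegmentPair.exists_isEncoding (h : IsSegmentPair a b c n k A B) (hn : 0 < n)
    (hk : 0 < k) : (∃ f, IsEncoding a b c k (segCount n k) (3 * segMid n k) A f) ∧
      ∃ g, IsEncoding a b c k (segCount n k) 0 B g := by
  obtain ⟨ε, s, β, γ, γ', hε, hε', hs, hβγ, hγ', hB, hA, -, -⟩ := h
  have h0 := segmentTimes_of_bounds hε hε' hs hβγ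
  exact ⟨(h0.update hγ').exists_isEncoding hn hk hA, h0.exists_isEncoding hn hk hB⟩

theorem IsSegmentPair.strict (h : IsSegmentPair a b c n k A B) :
    A ∈ TimedWord.strict α ∧ B ∈ TimedWord.strict α := by
  obtain ⟨ε, s, β, γ, γ', -, -, -, -, -, hB, hA, -, -⟩ := h
  exact ⟨hA.1, hB.1⟩

theorem IsSegmentPair.separated (h : IsSegmentPair a b c n k A B) (hn : 0 < n) (hk : 0 < k)
    (hab : a ≠ b) (hac : a ≠ c) (hbc : b ≠ c) :
    A ∈ (TPTL.witness a b c).lang ∧ B ∉ (TPTL.witness a b c).lang ∧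
      DuplicatorWins (TimeInterval.upTo k) n A B := by
  obtain ⟨⟨f, hf⟩, g, hg⟩ := h.exists_isEncoding hn hk
  exact ⟨hf.mem_witness_lang segMid_bounds.1 segMid_bounds.2, hg.notMem_witness_lang hab hac hbc,
    hf.duplicatorWins hg hk (Or.inr rfl) (Or.inl rfl)⟩

/-- In a word whose initial event is at `0` and whose other events are at an integer plus
`3/4 - η * N`, for pairwise distinct integers `N` small enough that these fractional parts
lie in `(0, 1)`, no two events are at an integral distance. -/
theorem noIntegralDistance_of_offsets {s : ℝ} {β γ : ℕ → ℝ} {η : ℝ} (hη : 0 < η) (z N : ℕ → ℤ)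
    (h : ∀ p, IsCode (segCount n k) p → p ≠ 0 → codeTime n k s β γ p = z p + (3 / 4 - η * N p) ∧
      0 < 3 / 4 - η * N p ∧ 3 / 4 - η * N p < 1)
    (hinj : ∀ p q, IsCode (segCount n k) p → IsCode (segCount n k) q → p ≠ 0 → q ≠ 0 →
      N p = N q → p = q) : NoIntegralDistance (segEvents a b c n k s β γ) := by
  have hno : ∀ (w : ℤ) (x : ℝ), 0 < x → x < 1 → (w : ℝ) ≠ x := fun w x h0 h1 he => by
    rw [← he] at h0 h1
    have h2 : 0 < w := by exact_mod_cast h0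
    have h3 : w < 1 := by exact_mod_cast h1
    omega
  have hzero : codeTime n k s β γ 0 = 0 := if_pos rfl
  rw [segEvents_eq_image]
  rintro _ ⟨p, hp, rfl⟩ _ ⟨q, hq, rfl⟩ hne w hw
  have hpq : p ≠ q := fun h => hne (by rw [h])
  dsimp only at hw
  by_cases hp0 : p = 0
  · obtain ⟨h1, h2, h3⟩ := h q hq (by omega)
    rw [hp0, hzero, h1] at hw
    exact hno (-w - z q) _ h2 h3 (by push_cast; linarith)
  by_cases hq0 : q = 0
  · obtain ⟨h1, h2, h3⟩ := h p hp hp0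
    rw [hq0, hzero, h1] at hw
    exact hno (w - z p) _ h2 h3 (by push_cast; linarith)
  obtain ⟨h1, h2, h3⟩ := h p hp hp0
  obtain ⟨h4, h5, h6⟩ := h q hq hq0
  rw [h1, h4] at hw
  have h7 : ((w - z p + z q : ℤ) : ℝ) = η * N q - η * N p := by push_cast; linarith
  have h8 : ((w - z p + z q : ℤ) : ℝ) < 1 := by linarith
  have h9 : (-1 : ℝ) < ((w - z p + z q : ℤ) : ℝ) := by linarith
  have h10 : w - z p + z q < 1 := by exact_mod_cast h8
  have h11 : -1 < w - z p + z q := by exact_mod_cast h9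
  rw [show w - z p + z q = 0 by omega, Int.cast_zero] at h7
  have h12 : (N p : ℝ) = N q := mul_left_cancel₀ hη.ne' (by linarith)
  exact hpq (hinj p q hp hq hp0 hq0 (by exact_mod_cast h12))

/-- The integer `N` for which the event with code `p ≠ 0` of the explicit segment words has fractional
part `3/4 - (δ / 16) * N`. The residues of `N` modulo `16` are `0` for an `a`, `8` for a `b`, `-1` for
a `c` and `1` for the moved `c`, so that distinct events have distinct `N`. -/
def gridIndex (d p : ℕ) : ℤ :=
  if p % 3 = 0 then 16 * (p / 3 : ℕ) - 16
  else if p % 3 = 1 then 16 * (p / 3 : ℕ) - 24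
  else if p = d + 8 then 16 * (p / 3 : ℕ) - 47
  else 16 * (p / 3 : ℕ) - 49

theorem noIntegralDistance_grid {d : ℕ} (hd : d % 3 = 0) {γ : ℕ → ℝ} (hn : 0 < n) (hk : 0 < k)
    (hγ : ∀ i, 1 ≤ i → γ i = segStart n k (k + 1 + 3 / 4) i + 2 +
      if 3 * i = d then - (segDelta n k / 16) else segDelta n k / 16) :
    NoIntegralDistance (segEvents a b c n k (k + 1 + 3 / 4)
      (fun i => segStart n k (k + 1 + 3 / 4) i + 2 - 3 / 2 * segDelta n k) γ) := by
  have hδ := segDelta_pos n k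
  have hδ' := segDelta_le hn hk
  refine noIntegralDistance_of_offsets (η := segDelta n k / 16) (by positivity)
    (fun p => k + ((p / 3 : ℕ) : ℤ)) (gridIndex d) (fun p hp hp0 => ⟨?_, ?_⟩)
    (fun p q hp hq hp0 hq0 h => ?_)
  · unfold IsCode at hp
    rw [codeTime, if_neg hp0, gridIndex]
    split_ifs with h0 h1 h2
    · unfold segStart
      generalize p / 3 = q
      push_cast
      ring
    · obtain ⟨q, hq⟩ : ∃ q, p / 3 = q + 2 := ⟨p / 3 - 2, by omega⟩
      rw [hq, segStart]
      push_cast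
      ring
    · obtain ⟨q, hq⟩ : ∃ q, p / 3 = q + 2 := ⟨p / 3 - 2, by omega⟩
      rw [hq, Nat.add_sub_cancel, hγ q (by omega), if_pos (by omega), segStart]
      push_cast
      ring
    · obtain ⟨q, hq⟩ : ∃ q, p / 3 = q + 2 := ⟨p / 3 - 2, by omega⟩
      rw [hq, Nat.add_sub_cancel, hγ q (by omega), if_neg (by omega), segStart]
      push_cast [Nat.add_sub_cancel]
      ring
  · have h1 : -1 ≤ gridIndex d p := by
      unfold IsCode at hp
      unfold gridIndex
      split_ifs <;> omega
    have h2 : gridIndex d p ≤ 16 * segCount n k + 8 := by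
      unfold IsCode at hp
      unfold gridIndex
      split_ifs <;> omega
    have h3 : (-1 : ℝ) ≤ gridIndex d p := by exact_mod_cast h1
    have h4 : (gridIndex d p : ℝ) ≤ 16 * segCount n k + 8 := by exact_mod_cast h2
    have h5 := mul_le_mul_of_nonneg_left h3 hδ.le
    have h6 := mul_le_mul_of_nonneg_left h4 hδ.le
    have h7 := segCount_mul_segDelta n k
    constructor <;> linarith
  · unfold IsCode at hp hq
    unfold gridIndex at h
    split_ifs at h <;> omega

/-- Segment pairs exist: take `ε = δ / 8` and `s = k + 1 + 3/4`, and choose the other time stamps so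
that the fractional parts are `3/4` minus distinct multiples of `δ / 16`. The drift of the segments
is less than `1/2`, so these fractional parts do not wrap around. -/
theorem exists_isSegmentPair (a b c : α) (hn : 0 < n) (hk : 0 < k) :
    ∃ A B : TimedWord α, IsSegmentPair a b c n k A B := by
  have hδ := segDelta_pos n k
  let s : ℝ := k + 1 + 3 / 4
  let β : ℕ → ℝ := fun i => segStart n k s i + 2 - 3 / 2 * segDelta n k
  let γ : ℕ → ℝ := fun i => segStart n k s i + 2 + segDelta n k / 16
  let γ' : ℝ := segStart n k s (segMid n k) + 2 - segDelta n k / 16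
  have hε : 0 < segDelta n k / 8 := by positivity
  have hε' : 4 * (segDelta n k / 8) < segDelta n k := by linarith
  have hs : (k : ℝ) + 1 ≤ s := by simp only [s]; linarith
  have hβγ : ∀ i, 1 ≤ i → i ≤ segCount n k →
      β i ∈ Set.Ioo (segStart n k s i + 2 - 2 * segDelta n k + 2 * (segDelta n k / 8))
        (segStart n k s i + 2 - segDelta n k - 2 * (segDelta n k / 8)) ∧
      γ i ∈ Set.Ioo (segStart n k s i + 2) (segStart n k s i + 2 + segDelta n k / 8) :=
    fun i _ _ => ⟨⟨by simp only [β]; linarith, by simp only [β]; linarith⟩,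
      by simp only [γ]; linarith, by simp only [γ]; linarith⟩
  have hγ' : γ' ∈ Set.Ioo (segStart n k s (segMid n k) + 2 - segDelta n k / 8)
      (segStart n k s (segMid n k) + 2) :=
    ⟨by simp only [γ']; linarith, by simp only [γ']; linarith⟩
  have h0 := segmentTimes_of_bounds hε hε' hs hβγ
  obtain ⟨B, hB⟩ := h0.exists_hasEvents a b c hn hk
  obtain ⟨A, hA⟩ := (h0.update hγ').exists_hasEvents a b c hn hk
  refine ⟨A, B, _, s, β, γ, γ', hε, hε', hs, hβγ, hγ', hB, hA, ?_, ?_⟩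
  · exact noIntegralDistance_grid (d := 0) rfl hn hk fun i hi => by rw [if_neg (by omega)]
  · refine noIntegralDistance_grid (d := 3 * segMid n k) (by omega) hn hk fun i _ => ?_
    by_cases hi : i = segMid n k
    · rw [hi, Function.update_self, if_pos rfl]
      simp only [γ', s]
      ring
    · rw [Function.update_of_ne hi, if_neg (by omega)]

end Pairs

theorem theorem4 {α : Type*} (a b c : α) (hab : a ≠ b) (hac : a ≠ c) (hbc : b ≠ c) :
    -- `TPTL[F]` is not contained in `MTL[U,S]`, over strictly and over weakly monotonic words
    ¬ (TPTL.languagesF (TimedWord.strict α) ⊆ MTL.languages (TimedWord.strict α)) ∧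
    ¬ (TPTL.languagesF (TimedWord.weak α) ⊆ MTL.languages (TimedWord.weak α)) ∧
    -- the witness formula: its fragment, its meaning, and its inexpressibility
    (TPTL.witness a b c).IsUnaryFuture ∧
    (∀ ρ : TimedWord α, ρ ∈ (TPTL.witness a b c).lang ↔
      ∃ i j l : Fin ρ.length, ρ.first < i ∧ i < j ∧ j < l ∧
        ρ.letter i = a ∧ ρ.letter j = b ∧ ρ.letter l = c ∧
        ρ.time j - ρ.time i ∈ Set.Ioo (1 : ℝ) 2 ∧ ρ.time l - ρ.time i ∈ Set.Ioo (1 : ℝ) 2) ∧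
    (TPTL.witness a b c).lang ∩ TimedWord.strict α ∉ MTL.languages (TimedWord.strict α) ∧
    (TPTL.witness a b c).lang ∩ TimedWord.weak α ∉ MTL.languages (TimedWord.weak α) ∧
    -- Duplicator wins on the two families of segment words
    (∀ n k : ℕ, 0 < n → 0 < k →
      (∃ A B : TimedWord α, IsSegmentPair a b c n k A B) ∧
      ∀ A B : TimedWord α, IsSegmentPair a b c n k A B →
        A ∈ (TPTL.witness a b c).lang ∧ B ∉ (TPTL.witness a b c).lang ∧
        DuplicatorWins (TimeInterval.upTo k) n A B) ∧
    -- strict containment of `MTL[U,S]` in `TPTL[U,S]`, over both classes of words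
    MTL.languages (TimedWord.strict α) ⊂ TPTL.languages (TimedWord.strict α) ∧
    MTL.languages (TimedWord.weak α) ⊂ TPTL.languages (TimedWord.weak α) := by
  have hnot : ∀ C : Set (TimedWord α), TimedWord.strict α ⊆ C →
      (TPTL.witness a b c).lang ∩ C ∉ MTL.languages C := fun C hC =>
    inter_notMem_languages fun n k hn hk => by
      obtain ⟨A, B, h⟩ := exists_isSegmentPair a b c hn hk
      exact ⟨A, hC h.strict.1, B, hC h.strict.2, h.separated hn hk hab hac hbc⟩
  have hF : ∀ C : Set (TimedWord α), (TPTL.witness a b c).lang ∩ C ∈ TPTL.languagesF C :=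
    fun C => ⟨_, TPTL.witness_isUnaryFuture a b c, rfl⟩
  have hs := hnot _ subset_rfl
  have hw := hnot (TimedWord.weak α) (Set.subset_univ _)
  exact ⟨fun h => hs (h (hF _)), fun h => hw (h (hF _)), TPTL.witness_isUnaryFuture a b c,
    fun ρ => TPTL.mem_witness_lang, hs, hw,
    fun n k hn hk => ⟨exists_isSegmentPair a b c hn hk,
      fun A B h => h.separated hn hk hab hac hbc⟩,
    ⟨MTL.languages_subset_tptl _, fun h => hs (h (TPTL.languagesF_subset_languages _ (hF _)))⟩,
    ⟨MTL.languages_subset_tptl _, fun h => hw (h (TPTL.languagesF_subset_languages _ (hF _)))⟩⟩
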